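/- Datasets of size $k$ over a universe $\mathcal U$ are multisets of $k$ records. Two datasets of equal size are neighbours, $X\simeq_S X'$, if $X'$ is obtained from $X$ by substituting one element by a different one, and $d(X,X')$ is the number of elements in which they differ. A mechanism $\mathcal M$ assigns to each dataset a probability measure on a measurable space; it is $(\epsilon,\delta)$-DP if $\mathcal M(X)(O)\le e^{\epsilon}\mathcal M(X')(O)+\delta$ for all $X\simeq_S X'$ and all measurable $O$. Its group privacy profile is $$\delta_j=\delta_{\mathcal M,j}(\epsilon)=\sup_{d(Y,Y')\le j}\ \sup_{O}\bigl(\mathcal M(Y)(O)-e^{\epsilon}\mathcal M(Y')(O)\bigr).$$ Let $n,b,m\ge 1$. The following schemes turn a dataset $X$ of size $n$ into a random dataset of size $m$. MUSTow$(n,b,m)$ (for $b<n$) draws $b$ records of $X$ without replacement and then $m$ records from these $b$ with replacement (so their occurrence frequencies are Multinomial$(m,(1/b,\dots,1/b))$). MUSTww$(n,b,m)$ draws $b$ records of $X$ with replacement and then $m$ from these $b$ with replacement. MUSTwo$(n,b,m)$ (for $m<b$) draws $b$ records of $X$ with replacement and then $m$ of these $b$ without replacement. **Theorem.** Let $\epsilon>0$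 and let $\mathcal M$ be an $(\epsilon,\delta)$-DP mechanism on datasets of size $m$. For each of the three schemes, the mechanism on datasets of size $n$ that applies $\mathcal M$ to the output of MUST$(n,b,m)$ is $(\epsilon',\delta')$-DP with $\epsilon'=\log(1+\eta(e^{\epsilon}-1))$ and with $\eta,\delta'$ as follows, where $B_j=\binom bj\left(\frac1n\right)^j\left(1-\frac1n\right)^{b-j}$ and $0^0=1$ (and $\binom{p}{q}=0$ for $p<q$): * MUSTwo: $\displaystyle \eta=\sum_{j=1}^b B_j\Bigl(1-\tfrac{\binom{b-j}{m}}{\binom bm}\Bigr)=1-\Bigl(1-\frac1n\Bigr)^m$ and $$\delta'=\sum_{j=1}^m B_j\sum_{u=1}^{j}\frac{\binom ju\binom{b-j}{m-u}}{\binom bm}\delta_u+\sum_{j=m+1}^b B_j\sum_{u=1}^{m}\frac{\binom ju\binom{b-j}{m-u}}{\binom bm}\delta_u=\sum_{j=1}^m\binom mj\Bigl(\frac1n\Bigr)^j\Bigl(1-\frac1n\Bigr)^{m-j}\delta_j;$$ * MUSTow: $\displaystyle \eta=\frac bn\Bigl(1-\Bigl(1-\frac1b\Bigr)^m\Bigr)$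 and $\displaystyle \delta'=\frac bn\sum_{j=1}^m\binom mj\Bigl(\frac1b\Bigr)^j\Bigl(1-\frac1b\Bigr)^{m-j}\delta_j$; * MUSTww: $\displaystyle \eta=\sum_{j=1}^b B_j\Bigl(1-\Bigl(1-\frac jb\Bigr)^m\Bigr)$ and $\displaystyle \delta'=\sum_{j=1}^b B_j\sum_{u=1}^m\binom mu\Bigl(\frac jb\Bigr)^u\Bigl(1-\frac jb\Bigr)^{m-u}\delta_u$. In each case, for every dataset $X$ of size $n$ and every element $v$ that occurs exactly once in $X$, $\eta$ is the probability that $v$ occurs in the output multiset $Y$ of the scheme, and $\delta'=\sum_{u=1}^m \Pr[v\text{ occurs exactly }u\text{ times in }Y]\,\delta_u$. Moreover $\eta\in(0,1)$ whenever $n\ge2$. -/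

import Mathlib

open scoped BigOperators

/-! Datasets of size `n` over a universe `U` are multisets of cardinality `n`, i.e. elements of
`Sym U n`.  A mechanism on datasets of size `n` is a map `Sym U n → ProbabilityMeasure Z`. -/

namespace Must

open MeasureTheory

section Privacy

variable {U Z : Type*} [MeasurableSpace Z] {n : ℕ}

/-- Substitution neighbours: `X'` arises from `X` by replacing one element by a different one. -/
def SubstNeighbor (X X' : Sym U n) : Prop :=
  ∃ (x₀ : Multiset U) (v v' : U), v ≠ v' ∧
    (X : Multiset U) = v ::ₘ x₀ ∧ (X' : Multiset U) = v' ::ₘ x₀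

/-- The number of elements in which two datasets of the same size differ. -/
def substDist [DecidableEq U] (X X' : Sym U n) : ℕ :=
  Multiset.card ((X : Multiset U) - (X' : Multiset U))

/-- `(ε, δ)`-differential privacy with respect to substitution. -/
def IsDP (M : Sym U n → ProbabilityMeasure Z) (ε δ : ℝ) : Prop :=
  ∀ X X' : Sym U n, SubstNeighbor X X' → ∀ O : Set Z, MeasurableSet O →
    (M X : Measure Z).real O ≤ Real.exp ε * (M X' : Measure Z).real O + δ

/-- The `α`-divergence `sup_O (μ(O) - α ν(O))` over measurable sets `O`. -/
noncomputable def alphaDiv (α : ℝ) (μ ν : ProbabilityMeasure Z) : ℝ :=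
  sSup {r : ℝ | ∃ O : Set Z, MeasurableSet O ∧
    r = (μ : Measure Z).real O - α * (ν : Measure Z).real O}

/-- The group privacy profile `δ_{M,j}(ε)`: the supremum of the `e^ε`-divergence over pairs of
datasets that differ in at most `j` elements. -/
noncomputable def groupProfile [DecidableEq U] (M : Sym U n → ProbabilityMeasure Z)
    (ε : ℝ) (j : ℕ) : ℝ :=
  sSup {r : ℝ | ∃ X X' : Sym U n, substDist X X' ≤ j ∧
    r = alphaDiv (Real.exp ε) (M X) (M X')}

/-- Run `M` on a random dataset produced by the sampling scheme `S`. -/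
noncomputable def subsampled {C D : Type*} (M : D → ProbabilityMeasure Z) (S : C → PMF D) :
    C → ProbabilityMeasure Z := fun X =>
  ⟨Measure.sum fun Y => S X Y • (M Y : Measure Z), ⟨by
    rw [Measure.sum_apply _ MeasurableSet.univ]
    simp [(S X).tsum_coe]⟩⟩

end Privacy

section Sampling

variable {U : Type*} {n : ℕ}

theorem coe_ne_zero_of_pos (hn : 0 < n) (X : Sym U n) : (X : Multiset U) ≠ 0 := by
  intro h
  have h1 := X.2
  have h2 : Multiset.card (X : Multiset U) = n := h1
  rw [h, Multiset.card_zero] at h2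
  omega

/-- Sampling with replacement: the multiset formed by `k` independent uniform draws from the
`n` records of `X`. Equivalently, the occurrence frequencies of the `n` records are
`Multinomial(k, (1/n, …, 1/n))`. -/
noncomputable def sampleWR (hn : 0 < n) (X : Sym U n) : (k : ℕ) → PMF (Sym U k)
  | 0 => PMF.pure Sym.nil
  | k + 1 => (PMF.ofMultiset (X : Multiset U) (coe_ne_zero_of_pos hn X)).bind fun a =>
      (sampleWR hn X k).map fun Y => a ::ₛ Y

/-- The sub-datasets of `X` of size `k`, one for each of the `n.choose k` choices of `k` of the
`n` records of `X` (counted with multiplicity). -/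
def subDatasets (k : ℕ) (X : Sym U n) : Multiset (Sym U k) :=
  (Multiset.powersetCard k (X : Multiset U)).pmap (fun s hs => Sym.mk s hs)
    fun _ hs => (Multiset.mem_powersetCard.1 hs).2

theorem subDatasets_ne_zero {k : ℕ} (hk : k ≤ n) (X : Sym U n) : subDatasets k X ≠ 0 := by
  intro h
  have h2 : Multiset.card (X : Multiset U) = n := X.2
  have h3 := congrArg Multiset.card h
  rw [subDatasets, Multiset.card_pmap, Multiset.card_powersetCard, h2, Multiset.card_zero] at h3
  exact (Nat.choose_pos hk).ne' h3

/-- Sampling `k` records without replacement. -/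
noncomputable def sampleWOR {k : ℕ} (hk : k ≤ n) (X : Sym U n) : PMF (Sym U k) :=
  PMF.ofMultiset (subDatasets k X) (subDatasets_ne_zero hk X)

/-- `MUSTow(n, b, m)`: `b` records without replacement, then `m` from these with replacement. -/
noncomputable def mustOW {b : ℕ} (m : ℕ) (hb : 0 < b) (hbn : b < n) (X : Sym U n) :
    PMF (Sym U m) :=
  (sampleWOR hbn.le X).bind fun Y => sampleWR hb Y m

/-- `MUSTww(n, b, m)`: `b` records with replacement, then `m` from these with replacement. -/
noncomputable def mustWW {b : ℕ} (m : ℕ) (hn : 0 < n) (hb : 0 < b) (X : Sym U n) :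
    PMF (Sym U m) :=
  (sampleWR hn X b).bind fun Y => sampleWR hb Y m

/-- `MUSTwo(n, b, m)`: `b` records with replacement, then `m` from these without replacement. -/
noncomputable def mustWO {b m : ℕ} (hn : 0 < n) (hmb : m < b) (X : Sym U n) :
    PMF (Sym U m) :=
  (sampleWR hn X b).bind fun Y => sampleWOR hmb.le Y

/-- The probability that `v` appears in a random dataset. -/
noncomputable def appearProb {m : ℕ} (p : PMF (Sym U m)) (v : U) : ℝ :=
  (p.toOuterMeasure {Y | v ∈ (Y : Multiset U)}).toReal

/-- The probability that `v` appears exactly `u` times in a random dataset. -/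
noncomputable def countProb [DecidableEq U] {m : ℕ} (p : PMF (Sym U m)) (v : U) (u : ℕ) : ℝ :=
  (p.toOuterMeasure {Y | (Y : Multiset U).count v = u}).toReal

end Sampling

section Formulas

/-- `ε' = log (1 + η (e^ε - 1))`. -/
noncomputable def epsAmp (η ε : ℝ) : ℝ := Real.log (1 + η * (Real.exp ε - 1))

noncomputable def etaWO (n b m : ℕ) : ℝ :=
  ∑ j ∈ Finset.Icc 1 b, (b.choose j : ℝ) * (1 / (n : ℝ)) ^ j * (1 - 1 / (n : ℝ)) ^ (b - j) *
    (1 - ((b - j).choose m : ℝ) / (b.choose m : ℝ))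

noncomputable def deltaWO (n b m : ℕ) (δ : ℕ → ℝ) : ℝ :=
  ∑ j ∈ Finset.Icc 1 m, (b.choose j : ℝ) * (1 / (n : ℝ)) ^ j * (1 - 1 / (n : ℝ)) ^ (b - j) *
    ∑ u ∈ Finset.Icc 1 j,
      (j.choose u : ℝ) * ((b - j).choose (m - u) : ℝ) / (b.choose m : ℝ) * δ u +
  ∑ j ∈ Finset.Icc (m + 1) b,
    (b.choose j : ℝ) * (1 / (n : ℝ)) ^ j * (1 - 1 / (n : ℝ)) ^ (b - j) *
    ∑ u ∈ Finset.Icc 1 m,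
      (j.choose u : ℝ) * ((b - j).choose (m - u) : ℝ) / (b.choose m : ℝ) * δ u

noncomputable def etaOW (n b m : ℕ) : ℝ :=
  (b : ℝ) / (n : ℝ) * (1 - (1 - 1 / (b : ℝ)) ^ m)

noncomputable def deltaOW (n b m : ℕ) (δ : ℕ → ℝ) : ℝ :=
  (b : ℝ) / (n : ℝ) * ∑ j ∈ Finset.Icc 1 m,
    (m.choose j : ℝ) * (1 / (b : ℝ)) ^ j * (1 - 1 / (b : ℝ)) ^ (m - j) * δ j

noncomputable def etaWW (n b m : ℕ) : ℝ :=
  ∑ j ∈ Finset.Icc 1 b, (b.choose j : ℝ) * (1 / (n : ℝ)) ^ j * (1 - 1 / (n : ℝ)) ^ (b - j) *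
    (1 - (1 - (j : ℝ) / (b : ℝ)) ^ m)

noncomputable def deltaWW (n b m : ℕ) (δ : ℕ → ℝ) : ℝ :=
  ∑ j ∈ Finset.Icc 1 b, (b.choose j : ℝ) * (1 / (n : ℝ)) ^ j * (1 - 1 / (n : ℝ)) ^ (b - j) *
    ∑ u ∈ Finset.Icc 1 m,
      (m.choose u : ℝ) * ((j : ℝ) / (b : ℝ)) ^ u * (1 - (j : ℝ) / (b : ℝ)) ^ (m - u) * δ u

end Formulas

end Must

/-! Fix a measurable set `O`, put `F Y = M(Y)(O)` and `α = e^ε`. For neighbours `v ::ₘ x` and `v'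
::ₘ x` the expectation of `F` under a scheme splits as `N + Q` and `N + Q'`. Here `N` collects the
outcomes that miss the differing record, and is the same for both; `Q` and `Q'` collect those that
hit it. Two inequalities suffice. Replacing the `u` drawn copies of `v` by `u` copies of `v'` gives
`Q ≤ α Q' + D`, with `D` the average of the `δ_u`. Replacing them by records of `x` compares a hit
with a miss: `(1 - η)(Q - D) ≤ η α N`. `add_le_of_jointConvexity` combines the two into `(ε',
δ')`-privacy.

The second inequality is the hard one: hits and misses must be coupled so that only the `u` copies
of `v` get replaced, since only then is the cost `δ_u`. The coupling has to match the number of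
copies of `v` in the intermediate dataset, and the number of second-stage draws that land on them.
In both places the hit weights dominate the miss weights in likelihood ratio, and
`sum_mul_sum_le_of_likelihoodRatio` replaces an explicit coupling. `GroupStable.hitSum_mul_le`
treats the second stage and serves all three schemes.

Expectations are written as powers of the operators `consSum s`. These commute, so the binomial
theorem sorts draws by origin. MUSTwo collapses to plain sampling with replacement by
`consSum_pow_sum_powersetCard`. The occurrence statements come from the same splitting, applied to
an `F` that depends only on the number of copies of `v`. -/

namespace Must

open MeasureTheory

/-! ### Likelihood-ratio comparison of sums, and joint convexity. -/

section LikelihoodRatio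

/-- With `H, H', G, G'` the quotients of `h, h', g, g'` by their weights, right side minus left side
equals `r ρ' ((G - H) + (G' - H')) + (r' ρ - r ρ') (G - H')`. The hypotheses `hz` and `gz` cover
vanishing weights. -/
theorem pair_le_of_likelihoodRatio {h h' r r' ρ ρ' g g' : ℝ} (hr : 0 ≤ r) (hr' : 0 ≤ r')
    (hρ : 0 ≤ ρ) (hρ' : 0 ≤ ρ')
    (hlr : r * ρ' ≤ r' * ρ) (h1 : h * ρ ≤ r * g) (h2 : h' * ρ' ≤ r' * g')
    (h3 : h' * ρ ≤ r' * g) (hz : r = 0 → h ≤ 0) (gz : ρ' = 0 → 0 ≤ g') :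
    h * ρ' + h' * ρ ≤ r * g' + r' * g := by
  rcases hr.eq_or_lt with hr0 | hr0
  · have := hz hr0.symm
    subst hr0
    nlinarith [mul_nonneg hρ' (neg_nonneg.2 this)]
  rcases hρ'.eq_or_lt with hρ0 | hρ0
  · have := gz hρ0.symm
    subst hρ0
    nlinarith [mul_nonneg hr this]
  have hpos : 0 < r' * ρ := lt_of_lt_of_le (mul_pos hr0 hρ0) hlr
  have hr'0 : 0 < r' := pos_of_mul_pos_left hpos hρ
  have hρ00 : 0 < ρ := pos_of_mul_pos_right hpos hr'
  obtain ⟨H, rfl⟩ : ∃ H, h = r * H := ⟨h / r, by field_simp⟩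
  obtain ⟨H', rfl⟩ : ∃ H, h' = r' * H := ⟨h' / r', by field_simp⟩
  obtain ⟨G, rfl⟩ : ∃ G, g = ρ * G := ⟨g / ρ, by field_simp⟩
  obtain ⟨G', rfl⟩ : ∃ G, g' = ρ' * G := ⟨g' / ρ', by field_simp⟩
  have e1 : H ≤ G := by
    have : (r * ρ) * H ≤ (r * ρ) * G := by linarith
    exact le_of_mul_le_mul_left this (by positivity)
  have e2 : H' ≤ G' := by
    have : (r' * ρ') * H' ≤ (r' * ρ') * G' := by linarith
    exact le_of_mul_le_mul_left this (by positivity)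
  have e3 : H' ≤ G := by
    have : (r' * ρ) * H' ≤ (r' * ρ) * G := by linarith
    exact le_of_mul_le_mul_left this (by positivity)
  have a1 : 0 ≤ (r * ρ') * ((G - H) + (G' - H')) :=
    mul_nonneg (by positivity) (by linarith)
  have a2 : 0 ≤ (r' * ρ - r * ρ') * (G - H') := mul_nonneg (by linarith) (by linarith)
  linarith

/-- If the weights `r` dominate the weights `ρ` in the likelihood ratio order and the `r`-averages
`h` lie below the `ρ`-averages `g` at all smaller indices, then the total average of `h` lies below
that of `g`. -/
theorem sum_mul_sum_le_of_likelihoodRatio {N : ℕ} {h r ρ g : ℕ → ℝ}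
    (hr : ∀ k ≤ N, 0 ≤ r k) (hρ : ∀ k ≤ N, 0 ≤ ρ k)
    (hlr : ∀ k l, k < l → l ≤ N → r k * ρ l ≤ r l * ρ k)
    (hle : ∀ l k, l ≤ k → k ≤ N → h k * ρ l ≤ r k * g l)
    (hz : ∀ k ≤ N, r k = 0 → h k ≤ 0) (gz : ∀ k ≤ N, ρ k = 0 → 0 ≤ g k) :
    (∑ k ∈ Finset.range (N + 1), h k) * ∑ k ∈ Finset.range (N + 1), ρ k ≤
      (∑ k ∈ Finset.range (N + 1), r k) * ∑ k ∈ Finset.range (N + 1), g k := by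
  -- A single term `h k * ρ l ≤ r k * g l` is not available for `k < l`; only its sum with the
  -- mirrored term is controlled, so the double sum is symmetrised.
  have key : ∀ k ∈ Finset.range (N + 1), ∀ l ∈ Finset.range (N + 1),
      h k * ρ l + h l * ρ k ≤ r k * g l + r l * g k := by
    intro k hk l hl
    have hk' : k ≤ N := Nat.lt_succ_iff.1 (Finset.mem_range.1 hk)
    have hl' : l ≤ N := Nat.lt_succ_iff.1 (Finset.mem_range.1 hl)
    rcases lt_trichotomy k l with hkl | rfl | hkl
    · exact pair_le_of_likelihoodRatio (hr k hk') (hr l hl') (hρ k hk') (hρ l hl')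
        (hlr k l hkl hl') (hle k k le_rfl hk') (hle l l le_rfl hl') (hle k l hkl.le hl')
        (hz k hk') (gz l hl')
    · linarith [hle k k le_rfl hk']
    · linarith [pair_le_of_likelihoodRatio (hr l hl') (hr k hk') (hρ l hl') (hρ k hk')
        (hlr l k hkl hk') (hle l l le_rfl hl') (hle k k le_rfl hk') (hle l k hkl.le hk')
        (hz l hl') (gz k hk')]
  have hsum := Finset.sum_le_sum fun k hk => Finset.sum_le_sum (key k hk)
  simp only [Finset.sum_add_distrib] at hsum
  rw [Finset.sum_comm (f := fun k l => h l * ρ k), Finset.sum_comm (f := fun k l => r l * g k)]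
    at hsum
  rw [Finset.sum_mul_sum, Finset.sum_mul_sum]
  linarith

/-- Advanced joint convexity in the form used for amplification by subsampling. -/
theorem add_le_of_jointConvexity {α η N Q Q' D : ℝ} (hα : 1 ≤ α)
    (h1 : Q ≤ α * Q' + D) (h2 : (1 - η) * Q ≤ η * (α * N) + (1 - η) * D)
    (hη : 0 ≤ η) :
    N + Q ≤ (1 + η * (α - 1)) * (N + Q') + D := by
  have hα0 : 0 < α := by linarith
  -- In `(1 + η(α - 1)) · h1 + (α - 1) · h2` the coefficients of `Q` and of `D` both become `α`.
  have a1 := mul_le_mul_of_nonneg_left h1 (by nlinarith : 0 ≤ 1 + η * (α - 1))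
  have a2 := mul_le_mul_of_nonneg_left h2 (by linarith : 0 ≤ α - 1)
  have : α * (N + Q) ≤ α * ((1 + η * (α - 1)) * (N + Q') + D) := by nlinarith
  exact le_of_mul_le_mul_left this hα0

end LikelihoodRatio

/-! ### Sums over sequences of draws as powers of commuting operators. -/

section ConsSum

variable {U : Type*}

/-- The operator `F ↦ (Z ↦ ∑ a ∈ s, F (a ::ₘ Z))`. Its `k`-th power sums over all sequences of
`k` elements of `s`. -/
def consSum (s : Multiset U) : Module.End ℝ (Multiset U → ℝ) where
  toFun F Z := (s.map fun a => F (a ::ₘ Z)).sum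
  map_add' F G := by ext Z; simp [Multiset.sum_map_add]
  map_smul' c F := by ext Z; simp [Multiset.sum_map_mul_left]

theorem consSum_apply (s : Multiset U) (F : Multiset U → ℝ) (Z : Multiset U) :
    consSum s F Z = (s.map fun a => F (a ::ₘ Z)).sum := rfl

theorem consSum_add (s t : Multiset U) : consSum (s + t) = consSum s + consSum t := by
  ext F Z; simp [consSum_apply]

theorem consSum_nsmul (k : ℕ) (s : Multiset U) : consSum (k • s) = k • consSum s := by
  induction k with
  | zero => ext F Z; simp [consSum_apply]
  | succ k ih => rw [succ_nsmul, succ_nsmul, consSum_add, ih]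

/-- Multisets forget the order of the draws. This is what makes the binomial theorem applicable to
`consSum (s + t)`. -/
theorem commute_consSum (s t : Multiset U) : Commute (consSum s) (consSum t) := by
  ext F Z
  simp only [Module.End.mul_apply, consSum_apply]
  rw [Multiset.sum_map_sum_map]
  simp_rw [Multiset.cons_swap]

theorem consSum_pow_succ_apply (s : Multiset U) (k : ℕ) (F : Multiset U → ℝ) (Z : Multiset U) :
    (consSum s ^ (k + 1)) F Z = (s.map fun a => (consSum s ^ k) F (a ::ₘ Z)).sum := by
  rw [pow_succ', Module.End.mul_apply, consSum_apply]

theorem consSum_pow_shift (s : Multiset U) (k : ℕ) (F : Multiset U → ℝ) (Z W : Multiset U) :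
    (consSum s ^ k) F (Z + W) = (consSum s ^ k) (fun Y => F (Y + W)) Z := by
  induction k generalizing Z with
  | zero => simp
  | succ k ih =>
    simp only [consSum_pow_succ_apply]
    congr 1
    refine Multiset.map_congr rfl fun a _ => ?_
    rw [← Multiset.cons_add, ih]

theorem consSum_pow_eq_zero_shift (s : Multiset U) (k : ℕ) (F : Multiset U → ℝ) (W : Multiset U) :
    (consSum s ^ k) F W = (consSum s ^ k) (fun Y => F (Y + W)) 0 := by
  rw [← consSum_pow_shift, zero_add]

/-- The coupling device: both sides use the same `k` draws from `s`, so only datasets that can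
really be drawn need comparing. -/
theorem consSum_pow_mono {s : Multiset U} {k : ℕ} {F G : Multiset U → ℝ} {Z : Multiset U}
    (h : ∀ Y : Multiset U, Multiset.card Y = k → (∀ a ∈ Y, a ∈ s) → F (Y + Z) ≤ G (Y + Z)) :
    (consSum s ^ k) F Z ≤ (consSum s ^ k) G Z := by
  induction k generalizing Z with
  | zero => simpa using h 0 rfl (by simp)
  | succ k ih =>
    simp only [consSum_pow_succ_apply]
    refine Multiset.sum_map_le_sum_map _ _ fun a ha => ih fun Y hY hs => ?_
    have := h (a ::ₘ Y) (by simp [hY]) (by simpa using ⟨ha, hs⟩)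
    simpa using this

theorem consSum_pow_congr {s : Multiset U} {k : ℕ} {F G : Multiset U → ℝ} {Z : Multiset U}
    (h : ∀ Y : Multiset U, Multiset.card Y = k → (∀ a ∈ Y, a ∈ s) → F (Y + Z) = G (Y + Z)) :
    (consSum s ^ k) F Z = (consSum s ^ k) G Z :=
  le_antisymm (consSum_pow_mono fun Y h1 h2 => (h Y h1 h2).le)
    (consSum_pow_mono fun Y h1 h2 => (h Y h1 h2).ge)

theorem consSum_pow_const (s : Multiset U) (k : ℕ) (c : ℝ) (Z : Multiset U) :
    (consSum s ^ k) (fun _ => c) Z = (Multiset.card s : ℝ) ^ k * c := by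
  induction k generalizing Z with
  | zero => simp
  | succ k ih => simp only [consSum_pow_succ_apply, ih]; simp; ring

theorem consSum_pow_nonneg {s : Multiset U} {k : ℕ} {F : Multiset U → ℝ} (hF : ∀ Y, 0 ≤ F Y)
    (Z : Multiset U) : 0 ≤ (consSum s ^ k) F Z := by
  have := consSum_pow_mono (s := s) (k := k) (F := fun _ => 0) (G := F) (Z := Z)
    fun Y _ _ => hF _
  rwa [consSum_pow_const, mul_zero] at this

theorem consSum_pow_mul_left (s : Multiset U) (k : ℕ) (c : ℝ) (F : Multiset U → ℝ)
    (Z : Multiset U) : (consSum s ^ k) (fun Y => c * F Y) Z = c * (consSum s ^ k) F Z :=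
  congrFun (map_smul (consSum s ^ k) c F) Z

theorem consSum_singleton_pow_apply (v : U) (k : ℕ) (F : Multiset U → ℝ) (Z : Multiset U) :
    (consSum {v} ^ k) F Z = F (k • {v} + Z) := by
  induction k generalizing Z with
  | zero => simp
  | succ k ih =>
    rw [consSum_pow_succ_apply]
    simp only [Multiset.map_singleton, Multiset.sum_singleton, ih]
    rw [succ_nsmul, add_assoc, Multiset.singleton_add]

/-- Binomial theorem for the commuting operators; `w` counts the draws that come from `t`. -/
theorem consSum_pow_add_apply (s t : Multiset U) (m : ℕ) (F : Multiset U → ℝ) (Z : Multiset U) :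
    (consSum (t + s) ^ m) F Z = ∑ w ∈ Finset.range (m + 1),
      (m.choose w : ℝ) * (consSum t ^ w) ((consSum s ^ (m - w)) F) Z := by
  rw [consSum_add, (commute_consSum t s).add_pow, LinearMap.sum_apply, Finset.sum_apply]
  refine Finset.sum_congr rfl fun w _ => ?_
  rw [← nsmul_eq_mul', LinearMap.smul_apply, Pi.smul_apply, nsmul_eq_mul, Module.End.mul_apply]

/-- Expansion according to the number of draws that hit one of the `k` copies of `v`. -/
theorem consSum_pow_nsmul_add_apply (s : Multiset U) (v : U) (k m : ℕ) (F : Multiset U → ℝ) :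
    (consSum (k • {v} + s) ^ m) F 0 = ∑ u ∈ Finset.range (m + 1),
      (m.choose u : ℝ) * ((k : ℝ) ^ u * (consSum s ^ (m - u)) F (u • {v})) := by
  rw [consSum_pow_add_apply]
  refine Finset.sum_congr rfl fun u _ => ?_
  rw [consSum_nsmul, ← Nat.cast_smul_eq_nsmul ℝ, smul_pow, LinearMap.smul_apply, Pi.smul_apply,
    consSum_singleton_pow_apply, add_zero, smul_eq_mul]

end ConsSum

/-! ### Draws sorted by the number of hits on `v`. -/

section Hit

variable {U : Type*}

theorem sum_range_succ_eq_add_sum_Icc (f : ℕ → ℝ) (m : ℕ) :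
    ∑ u ∈ Finset.range (m + 1), f u = f 0 + ∑ u ∈ Finset.Icc 1 m, f u := by
  rw [Finset.range_eq_Ico, Finset.sum_eq_sum_Ico_succ_bot (Nat.succ_pos m)]
  rfl

theorem sum_range_succ_ite_eq_sum_Icc (f : ℕ → ℝ) (m : ℕ) :
    ∑ u ∈ Finset.range (m + 1), (if u = 0 then 0 else f u) = ∑ u ∈ Finset.Icc 1 m, f u := by
  rw [sum_range_succ_eq_add_sum_Icc]
  simp only [if_true, zero_add]
  refine Finset.sum_congr rfl fun u hu => if_neg ?_
  have := (Finset.mem_Icc.1 hu).1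
  omega

/-- `F` decreases at most by the factor `α` and the summand `δ u` when `u` elements of a dataset of
size `m` are replaced. -/
def GroupStable (α : ℝ) (δ : ℕ → ℝ) (m : ℕ) (F : Multiset U → ℝ) : Prop :=
  ∀ A R Y : Multiset U, Multiset.card A = Multiset.card R → 1 ≤ Multiset.card A →
    Multiset.card A + Multiset.card Y = m → F (A + Y) ≤ α * F (R + Y) + δ (Multiset.card A)

/-- Unnormalized expectation of `F` over `m` draws from `s` and `k` copies of `v`, restricted to
the event that some copy of `v` is drawn. -/
noncomputable def hitSum (m : ℕ) (F : Multiset U → ℝ) (v : U) (k : ℕ) (s : Multiset U) : ℝ :=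
  ∑ u ∈ Finset.Icc 1 m, (m.choose u : ℝ) * ((k : ℝ) ^ u * (consSum s ^ (m - u)) F (u • {v}))

/-- Sum of `δ u` over the sequences of `m` draws out of `c + k` that hit a set of size `k` exactly
`u ≥ 1` times. -/
noncomputable def hitWeight (m : ℕ) (δ : ℕ → ℝ) (k c : ℕ) : ℝ :=
  ∑ u ∈ Finset.Icc 1 m, (m.choose u : ℝ) * ((k : ℝ) ^ u * (c : ℝ) ^ (m - u)) * δ u

theorem consSum_pow_eq_add_hitSum (m : ℕ) (F : Multiset U → ℝ) (v : U) (k : ℕ) (s : Multiset U) :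
    (consSum (k • {v} + s) ^ m) F 0 = (consSum s ^ m) F 0 + hitSum m F v k s := by
  rw [consSum_pow_nsmul_add_apply, sum_range_succ_eq_add_sum_Icc, hitSum]
  simp

/-- For `δ = 1` the weight counts the hitting sequences, and `c ^ m` counts the missing ones. Hence
`η` is the case `δ = 1` of `δ'` throughout. -/
theorem add_hitWeight_one (m k c : ℕ) :
    (c : ℝ) ^ m + hitWeight m (fun _ => 1) k c = ((k : ℝ) + c) ^ m := by
  rw [add_pow, sum_range_succ_eq_add_sum_Icc, hitWeight]
  simp [mul_comm]

theorem hitWeight_nonneg {m : ℕ} {δ : ℕ → ℝ} (hδ : ∀ u, 0 ≤ δ u) (k c : ℕ) :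
    0 ≤ hitWeight m δ k c :=
  Finset.sum_nonneg fun u _ => mul_nonneg (by positivity) (hδ u)

section Stable

variable {α : ℝ} {δ : ℕ → ℝ} {m : ℕ} {F : Multiset U → ℝ}

/-- The remaining `m - u` draws are shared by both sides, so exchanging `A` for `R` costs `δ u` for
each sequence of them. -/
theorem GroupStable.consSum_pow_le (hF : GroupStable α δ m F) (s : Multiset U) {u : ℕ}
    (hu : u ∈ Finset.Icc 1 m) {A R : Multiset U} (hA : Multiset.card A = u)
    (hR : Multiset.card R = u) :
    (consSum s ^ (m - u)) F A ≤
      α * (consSum s ^ (m - u)) F R + (Multiset.card s : ℝ) ^ (m - u) * δ u := by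
  obtain ⟨hu1, hum⟩ := Finset.mem_Icc.1 hu
  rw [consSum_pow_eq_zero_shift s _ F A, consSum_pow_eq_zero_shift s _ F R,
    ← consSum_pow_const s (m - u) (δ u) 0, ← consSum_pow_mul_left, ← Pi.add_apply, ← map_add]
  refine consSum_pow_mono fun Y hY _ => ?_
  have := hF A R Y (by omega) (by omega) (by omega)
  simpa [add_comm, hA] using this

/-- The inequality `Q ≤ α Q' + D`: for each `u`, the `u` copies of `v` become `u` copies of `v'`. -/
theorem GroupStable.hitSum_le (hF : GroupStable α δ m F) (v v' : U) (k : ℕ) (s : Multiset U) :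
    hitSum m F v k s ≤ α * hitSum m F v' k s + hitWeight m δ k (Multiset.card s) := by
  rw [hitSum, hitSum, hitWeight, Finset.mul_sum, ← Finset.sum_add_distrib]
  refine Finset.sum_le_sum fun u hu => ?_
  have := mul_le_mul_of_nonneg_left
    (hF.consSum_pow_le s hu (A := u • {v}) (R := u • {v'}) (by simp) (by simp))
    (by positivity : (0 : ℝ) ≤ (m.choose u : ℝ) * (k : ℝ) ^ u)
  linarith

/-- Here `r` takes the place of the `k` copies of `v`. The number `u ≥ 1` of hits on `v` dominates
in likelihood ratio the number `w` of hits on `r`, because `card r ≤ k`. For `w ≤ u` the `u` copies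
of `v` are exchanged for `w` draws from `r` and `u - w` further draws from `s`, at cost `δ u`
whatever `w` is. -/
theorem GroupStable.hitSum_mul_le (hF : GroupStable α δ m F) (hα : 0 ≤ α) (hδ : ∀ u, 0 ≤ δ u)
    (hF0 : ∀ Y, 0 ≤ F Y) (hF1 : ∀ Y, F Y ≤ 1) (v : U) (k : ℕ) (s r : Multiset U)
    (hr : Multiset.card r ≤ k) :
    (hitSum m F v k s - hitWeight m δ k (Multiset.card s)) *
        ((Multiset.card r : ℝ) + Multiset.card s) ^ m ≤
      hitWeight m (fun _ => 1) k (Multiset.card s) * (α * (consSum (r + s) ^ m) F 0) := by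
  have hr' : (Multiset.card r : ℝ) ≤ k := by exact_mod_cast hr
  set p : ℝ := (Multiset.card r : ℝ) with hp
  have hp0 : 0 ≤ p := by positivity
  set c : ℝ := (Multiset.card s : ℝ) with hc
  have hc0 : 0 ≤ c := by positivity
  -- The cost `δ u` is subtracted inside `h`, and the term `u = 0` is zeroed because a hit is
  -- required.
  have main := sum_mul_sum_le_of_likelihoodRatio (N := m)
    (h := fun u => if u = 0 then 0 else (m.choose u : ℝ) * ((k : ℝ) ^ u *
      ((consSum s ^ (m - u)) F (u • {v}) - c ^ (m - u) * δ u)))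
    (r := fun u => if u = 0 then 0 else (m.choose u : ℝ) * ((k : ℝ) ^ u * c ^ (m - u)))
    (ρ := fun w => (m.choose w : ℝ) * (p ^ w * c ^ (m - w)))
    (g := fun w => (m.choose w : ℝ) * (α * (consSum r ^ w) ((consSum s ^ (m - w)) F) 0))
    ?_ ?_ ?_ ?_ ?_ ?_
  · rw [sum_range_succ_ite_eq_sum_Icc, sum_range_succ_ite_eq_sum_Icc] at main
    convert main using 2
    · rw [hitSum, hitWeight, ← Finset.sum_sub_distrib]
      exact Finset.sum_congr rfl fun u _ => by ring
    · rw [add_pow]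
      exact Finset.sum_congr rfl fun u _ => by ring
    · simp [hitWeight, hc]
    · rw [consSum_pow_add_apply, Finset.mul_sum]
      exact Finset.sum_congr rfl fun u _ => by ring
  · intro u _
    split_ifs <;> positivity
  · intro u _
    positivity
  · intro u w huw hwm
    rw [if_neg (by omega : w ≠ 0)]
    split_ifs with h0
    · rw [zero_mul]; positivity
    · obtain ⟨d, rfl⟩ := Nat.exists_eq_add_of_lt huw
      have e : p ^ (d + 1) ≤ (k : ℝ) ^ (d + 1) := pow_le_pow_left₀ hp0 hr' _
      have := mul_le_mul_of_nonneg_left e (by positivity : 0 ≤ (m.choose u : ℝ) *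
        (m.choose (u + d + 1) : ℝ) * c ^ (m - u) * c ^ (m - (u + d + 1)) * (k : ℝ) ^ u * p ^ u)
      have e1 : p ^ (u + d + 1) = p ^ u * p ^ (d + 1) := by rw [← pow_add, add_assoc]
      have e2 : (k : ℝ) ^ (u + d + 1) = (k : ℝ) ^ u * (k : ℝ) ^ (d + 1) := by
        rw [← pow_add, add_assoc]
      rw [e1, e2]
      linarith
  · intro w u hwu hum
    split_ifs with h0
    · simp
    have hu : u ∈ Finset.Icc 1 m := Finset.mem_Icc.2 ⟨by omega, hum⟩
    set A := (consSum s ^ (m - u)) F (u • {v}) - c ^ (m - u) * δ u with hA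
    have hsplit : m - w = (u - w) + (m - u) := by omega
    -- The constant `A` may be averaged over any draws; `p ^ w * c ^ (u - w)` counts the pairs of
    -- replacement sequences from `r` and from `s`.
    have step : p ^ w * c ^ (u - w) * A ≤ α * (consSum r ^ w) ((consSum s ^ (m - w)) F) 0 := by
      have e : p ^ w * c ^ (u - w) * A =
          (consSum r ^ w) ((consSum s ^ (u - w)) fun _ => A) 0 := by
        have : ((consSum s ^ (u - w)) fun _ => A) = fun _ => c ^ (u - w) * A := by
          ext Z; exact consSum_pow_const _ _ _ _
        rw [this, consSum_pow_const]
        ring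
      rw [e, hsplit, pow_add, ← consSum_pow_mul_left]
      refine consSum_pow_mono fun R hR _ => ?_
      rw [Module.End.mul_apply, ← consSum_pow_mul_left]
      refine consSum_pow_mono fun Y hY _ => ?_
      have := hF.consSum_pow_le s hu (A := u • {v}) (R := Y + (R + 0)) (by simp)
        (by simp [hR, hY]; omega)
      linarith
    rw [hsplit, pow_add, ← hsplit]
    have := mul_le_mul_of_nonneg_left step (by positivity : 0 ≤ (m.choose u : ℝ) *
        (m.choose w : ℝ) * (k : ℝ) ^ u * c ^ (m - u))
    linarith
  · intro u hum
    split_ifs with h0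
    · simp
    intro hz
    -- If the weight is zero, `F ≤ 1` and `0 ≤ δ u` still bound the term by that weight.
    have hA : (consSum s ^ (m - u)) F (u • {v}) ≤ c ^ (m - u) * 1 := by
      rw [hc, ← consSum_pow_const s (m - u) 1 (u • {v})]
      exact consSum_pow_mono fun Y _ _ => hF1 _
    have hd : 0 ≤ c ^ (m - u) * δ u := mul_nonneg (by positivity) (hδ u)
    have := mul_le_mul_of_nonneg_left
      (by linarith : (consSum s ^ (m - u)) F (u • {v}) - c ^ (m - u) * δ u ≤ c ^ (m - u))
      (by positivity : 0 ≤ (m.choose u : ℝ) * (k : ℝ) ^ u)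
    linarith
  · intro w _ _
    exact mul_nonneg (by positivity) (mul_nonneg hα
      (consSum_pow_nonneg (fun Y => consSum_pow_nonneg hF0 Y) 0))

end Stable

end Hit

/-! ### The privacy inequality for each scheme. -/

section Amplification

variable {U : Type*} {α : ℝ} {δ : ℕ → ℝ} {m : ℕ} {F : Multiset U → ℝ}

/-- Unnormalized joint convexity: `C` counts the outcomes missing the record, `W` those hitting it,
so `η = W / T` and `1 - η = C / T`. -/
theorem div_le_of_jointConvexity {α N Q Q' D C W T : ℝ} (hα : 1 ≤ α) (hT : 0 < T)
    (hTe : C + W = T) (hW : 0 ≤ W) (h1 : Q ≤ α * Q' + D) (h2 : (Q - D) * C ≤ W * (α * N)) :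
    (N + Q) / T ≤ (1 + W / T * (α - 1)) * ((N + Q') / T) + D / T := by
  have key := add_le_of_jointConvexity (α := α) (η := W / T) (N := N / T) (Q := Q / T)
    (Q' := Q' / T) (D := D / T) hα ?_ ?_ (by positivity)
  · rwa [add_div, add_div]
  · rw [← mul_div_assoc, ← add_div]
    exact div_le_div_of_nonneg_right h1 hT.le
  · have e : 1 - W / T = C / T := by rw [← hTe] at hT ⊢; field_simp; ring
    rw [e]
    have := div_le_div_of_nonneg_right h2 (mul_pos hT hT).le
    have e2 : C / T * (Q / T) - C / T * (D / T) = (Q - D) * C / (T * T) := by field_simp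
    have e3 : W / T * (α * (N / T)) = W * (α * N) / (T * T) := by field_simp
    linarith

theorem hitSum_le_hitWeight (hF1 : ∀ Y, F Y ≤ 1) (v : U) (k : ℕ) (s : Multiset U) :
    hitSum m F v k s ≤ hitWeight m (fun _ => 1) k (Multiset.card s) := by
  refine Finset.sum_le_sum fun u _ => ?_
  rw [mul_one]
  refine mul_le_mul_of_nonneg_left (mul_le_mul_of_nonneg_left ?_ (by positivity)) (by positivity)
  rw [← mul_one ((Multiset.card s : ℝ) ^ _), ← consSum_pow_const s (m - u) 1 (u • {v})]
  exact consSum_pow_mono fun Y _ _ => hF1 _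

/-- Used for the occurrence probabilities: such an `F` sees only the number of copies of `v`, and
draws from `s` add none. -/
theorem consSum_pow_eq_of_notMem {v : U} {s : Multiset U} (hv : v ∉ s) {φ : ℕ → ℝ}
    (hφ : ∀ u Y, v ∉ Y → F (Y + u • {v}) = φ u) (j u : ℕ) :
    (consSum s ^ j) F (u • {v}) = (Multiset.card s : ℝ) ^ j * φ u := by
  rw [← consSum_pow_const s j (φ u) (u • {v})]
  exact consSum_pow_congr fun Y _ hY => hφ u Y fun h => hv (hY v h)

theorem hitSum_eq_of_notMem {v : U} {s : Multiset U} (hv : v ∉ s) {φ : ℕ → ℝ}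
    (hφ : ∀ u Y, v ∉ Y → F (Y + u • {v}) = φ u) (k : ℕ) :
    hitSum m F v k s = hitWeight m φ k (Multiset.card s) := by
  refine Finset.sum_congr rfl fun u _ => ?_
  rw [consSum_pow_eq_of_notMem hv hφ]
  ring

theorem consSum_pow_eq_zero_of_notMem {v : U} {s : Multiset U} (hv : v ∉ s) {φ : ℕ → ℝ}
    (hφ : ∀ u Y, v ∉ Y → F (Y + u • {v}) = φ u) (h0 : φ 0 = 0) (j : ℕ) :
    (consSum s ^ j) F 0 = 0 := by
  have := consSum_pow_eq_of_notMem hv hφ j 0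
  rwa [zero_smul, h0, mul_zero] at this

/-! ### Sampling with replacement in one stage. -/

section WithReplacement

theorem consSum_cons_pow (v : U) (x : Multiset U) :
    (consSum (v ::ₘ x) ^ m) F 0 = (consSum x ^ m) F 0 + hitSum m F v 1 x := by
  rw [← consSum_pow_eq_add_hitSum, one_smul, Multiset.singleton_add]

theorem GroupStable.consSum_cons_pow_div_le (hF : GroupStable α δ m F) (hα : 1 ≤ α)
    (hδ : ∀ u, 0 ≤ δ u) (hF0 : ∀ Y, 0 ≤ F Y) (hF1 : ∀ Y, F Y ≤ 1) (v v' : U)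
    (x : Multiset U) {n : ℕ} (hn : n = Multiset.card x + 1) :
    (consSum (v ::ₘ x) ^ m) F 0 / (n : ℝ) ^ m ≤
      (1 + hitWeight m (fun _ => 1) 1 (Multiset.card x) / (n : ℝ) ^ m * (α - 1)) *
        ((consSum (v' ::ₘ x) ^ m) F 0 / (n : ℝ) ^ m) +
      hitWeight m δ 1 (Multiset.card x) / (n : ℝ) ^ m := by
  subst hn
  rw [consSum_cons_pow, consSum_cons_pow]
  refine div_le_of_jointConvexity (C := (Multiset.card x : ℝ) ^ m) hα (by positivity) ?_
    (hitWeight_nonneg (fun _ => zero_le_one) _ _) (hF.hitSum_le v v' 1 x) ?_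
  · rw [add_hitWeight_one]
    push_cast
    ring
  -- A miss consists of draws from `x` alone, so nothing takes the place of `v` and `r = 0`.
  · have := hF.hitSum_mul_le (by linarith) hδ hF0 hF1 v 1 x 0 (by simp)
    simpa using this

end WithReplacement

/-! ### MUSTow. -/

section WithoutThenWith

/-- Double counting: each choice of `b + 1` records arises from `b + 1` pairs of a choice `s` of `b`
records and one further record `a`. -/
theorem sum_powersetCard_sum_sub [DecidableEq U] (Φ : Multiset U → ℝ) (x : Multiset U) (b : ℕ) :
    ((x.powersetCard b).map fun s => ((x - s).map fun a => Φ (a ::ₘ s)).sum).sum =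
      ((b : ℝ) + 1) * ((x.powersetCard (b + 1)).map Φ).sum := by
  induction x using Multiset.induction_on generalizing b Φ with
  | empty =>
    cases b <;> simp [Multiset.powersetCard_zero_right]
  | cons a y ih =>
    have step : ∀ c, ((y.powersetCard c).map fun s =>
        (((a ::ₘ y) - s).map fun z => Φ (z ::ₘ s)).sum).sum =
        ((y.powersetCard c).map fun s => Φ (a ::ₘ s)).sum +
        ((c : ℝ) + 1) * ((y.powersetCard (c + 1)).map Φ).sum := by
      intro c
      rw [← ih, ← Multiset.sum_map_add]
      congr 1
      refine Multiset.map_congr rfl fun s hs => ?_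
      rw [Multiset.cons_sub_of_le a (Multiset.mem_powersetCard.1 hs).1, Multiset.map_cons,
        Multiset.sum_cons]
    cases b with
    | zero =>
      rw [Multiset.powersetCard_cons, Multiset.map_add, Multiset.sum_add]
      have := step 0
      simp only [Multiset.powersetCard_zero_left, Multiset.map_singleton,
        Multiset.sum_singleton] at this ⊢
      rw [this]
      simp
      ring
    | succ b =>
      rw [Multiset.powersetCard_cons, Multiset.map_add, Multiset.sum_add, step,
        Multiset.powersetCard_cons, Multiset.map_add, Multiset.sum_add, Multiset.map_map,
        Multiset.map_map]
      have := ih (fun s => Φ (a ::ₘ s)) b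
      simp only [Function.comp_def, Multiset.sub_cons, Multiset.erase_cons_head] at this ⊢
      simp_rw [Multiset.cons_swap a] at this
      rw [this]
      push_cast
      ring

/-- Three kinds of outcome: `v` is not among the chosen records; it is chosen but missed by the
second stage; it is hit. The first two form `N`. -/
theorem sum_powersetCard_cons_consSum_pow (v : U) (x : Multiset U) (b : ℕ) :
    (((v ::ₘ x).powersetCard (b + 1)).map fun s => (consSum s ^ m) F 0).sum =
      (((x.powersetCard (b + 1)).map fun s => (consSum s ^ m) F 0).sum +
        ((x.powersetCard b).map fun s => (consSum s ^ m) F 0).sum) +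
      ((x.powersetCard b).map fun s => hitSum m F v 1 s).sum := by
  rw [Multiset.powersetCard_cons, Multiset.map_add, Multiset.sum_add, Multiset.map_map, add_assoc,
    ← Multiset.sum_map_add]
  simp only [Function.comp_def, consSum_cons_pow]

theorem sum_map_powersetCard_const (x : Multiset U) (b : ℕ) (c : ℝ) :
    ((x.powersetCard b).map fun _ => c).sum = ((Multiset.card x).choose b : ℝ) * c := by
  simp

theorem GroupStable.sum_powersetCard_cons_div_le [DecidableEq U] (hF : GroupStable α δ m F)
    (hα : 1 ≤ α)
    (hδ : ∀ u, 0 ≤ δ u) (hF0 : ∀ Y, 0 ≤ F Y) (hF1 : ∀ Y, F Y ≤ 1) (v v' : U)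
    (x : Multiset U) {n b : ℕ} (hn : n = Multiset.card x + 1) (hbn : b + 1 < n) :
    (((v ::ₘ x).powersetCard (b + 1)).map fun s => (consSum s ^ m) F 0).sum /
        ((n.choose (b + 1) : ℝ) * ((b + 1 : ℕ) : ℝ) ^ m) ≤
      (1 + (((n - 1).choose b : ℝ) * hitWeight m (fun _ => 1) 1 b) /
          ((n.choose (b + 1) : ℝ) * ((b + 1 : ℕ) : ℝ) ^ m) * (α - 1)) *
        ((((v' ::ₘ x).powersetCard (b + 1)).map fun s => (consSum s ^ m) F 0).sum /
          ((n.choose (b + 1) : ℝ) * ((b + 1 : ℕ) : ℝ) ^ m)) +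
      (((n - 1).choose b : ℝ) * hitWeight m δ 1 b) /
          ((n.choose (b + 1) : ℝ) * ((b + 1 : ℕ) : ℝ) ^ m) := by
  have hc : n - 1 = Multiset.card x := by omega
  have hpos : 0 < n.choose (b + 1) := Nat.choose_pos hbn.le
  rw [sum_powersetCard_cons_consSum_pow, sum_powersetCard_cons_consSum_pow]
  refine div_le_of_jointConvexity
    (C := ((n - 1).choose (b + 1) : ℝ) * ((b + 1 : ℕ) : ℝ) ^ m + ((n - 1).choose b : ℝ) * b ^ m)
    hα (by positivity) ?_ (mul_nonneg (by positivity)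
      (hitWeight_nonneg (fun _ => zero_le_one) _ _)) ?_ ?_
  · have e1 : n.choose (b + 1) = (n - 1).choose b + (n - 1).choose (b + 1) := by
      rw [hn]; exact Nat.choose_succ_succ _ _
    have e2 := add_hitWeight_one m 1 b
    rw [e1]
    push_cast at e2 ⊢
    rw [add_comm (b : ℝ) 1, ← e2]
    ring
  · rw [hc, ← sum_map_powersetCard_const, ← Multiset.sum_map_mul_left, ← Multiset.sum_map_add]
    refine Multiset.sum_map_le_sum_map _ _ fun s hs => ?_
    have := hF.hitSum_le v v' 1 s
    rwa [(Multiset.mem_powersetCard.1 hs).2] at this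
  · set A : Multiset U → ℝ := fun s => hitSum m F v 1 s - hitWeight m δ 1 b with hA
    set W := hitWeight m (fun _ => 1) 1 b
    set S := ((x.powersetCard b).map A).sum with hS
    have eS : ((x.powersetCard b).map fun s => hitSum m F v 1 s).sum -
        ((n - 1).choose b : ℝ) * hitWeight m δ 1 b = S := by
      rw [hc, ← sum_map_powersetCard_const, ← Multiset.sum_map_sub]
    rw [eS]
    set G₁ := ((x.powersetCard (b + 1)).map fun s => (consSum s ^ m) F 0).sum with hG₁
    set G₀ := ((x.powersetCard b).map fun s => (consSum s ^ m) F 0).sum with hG₀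
    -- Compared with misses where `v` was chosen but not drawn again: `r = 0`.
    have h0 : S * (b : ℝ) ^ m ≤ W * (α * G₀) := by
      rw [hS, hG₀, ← Multiset.sum_map_mul_left, ← Multiset.sum_map_mul_left,
        ← Multiset.sum_map_mul_right]
      refine Multiset.sum_map_le_sum_map _ _ fun s hs => ?_
      have := hF.hitSum_mul_le (by linarith) hδ hF0 hF1 v 1 s 0 (by simp)
      simpa [(Multiset.mem_powersetCard.1 hs).2] using this
    -- Compared with misses where `v` was not chosen: another record `a` of `x - s` fills its place,
    -- `r = {a}`, and summing over `a` brings in the double count.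
    have h1 : ((Multiset.card x - b : ℕ) : ℝ) * (S * ((b + 1 : ℕ) : ℝ) ^ m) ≤
        W * (α * (((b : ℝ) + 1) * G₁)) := by
      rw [hG₁, ← sum_powersetCard_sum_sub, hS, ← Multiset.sum_map_mul_right,
        ← Multiset.sum_map_mul_left, ← Multiset.sum_map_mul_left, ← Multiset.sum_map_mul_left]
      refine Multiset.sum_map_le_sum_map _ _ fun s hs => ?_
      obtain ⟨hsx, hsb⟩ := Multiset.mem_powersetCard.1 hs
      have ec : ((Multiset.card x - b : ℕ) : ℝ) * (A s * ((b + 1 : ℕ) : ℝ) ^ m) =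
          ((x - s).map fun _ => A s * ((b + 1 : ℕ) : ℝ) ^ m).sum := by
        simp [Multiset.card_sub hsx, hsb]
      rw [ec, ← Multiset.sum_map_mul_left, ← Multiset.sum_map_mul_left]
      refine Multiset.sum_map_le_sum_map _ _ fun a _ => ?_
      have := hF.hitSum_mul_le (by linarith) hδ hF0 hF1 v 1 s {a} (by simp)
      rw [hsb, Multiset.singleton_add, Multiset.card_singleton] at this
      rw [hA]
      push_cast at this ⊢
      rwa [add_comm (b : ℝ) 1]
    have hch : ((n - 1).choose (b + 1) : ℝ) * ((b : ℝ) + 1) =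
        ((n - 1).choose b : ℝ) * ((Multiset.card x - b : ℕ) : ℝ) := by
      rw [hc]
      exact_mod_cast Nat.choose_succ_right_eq _ _
    have h0' := mul_le_mul_of_nonneg_left h0 (Nat.cast_nonneg ((n - 1).choose b) : (0:ℝ) ≤ _)
    have h1' := mul_le_mul_of_nonneg_left h1 (Nat.cast_nonneg ((n - 1).choose b) : (0:ℝ) ≤ _)
    rw [← mul_assoc, ← hch] at h1'
    have h1'' : ((n - 1).choose (b + 1) : ℝ) * (S * ((b + 1 : ℕ) : ℝ) ^ m) ≤
        ((n - 1).choose b : ℝ) * (W * (α * G₁)) := by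
      have hb : (0 : ℝ) < (b : ℝ) + 1 := by positivity
      refine le_of_mul_le_mul_left ?_ hb
      linarith
    linarith

end WithoutThenWith

/-! ### MUSTww. -/

section WithThenWith

/-- Here `k` is the number of copies of `v` in the intermediate dataset. The first sum, where the
second stage misses them all, does not depend on `v`. -/
theorem consSum_cons_pow_consSum_pow (v : U) (x : Multiset U) (b : ℕ) :
    (consSum (v ::ₘ x) ^ b) (fun s => (consSum s ^ m) F 0) 0 =
      (∑ k ∈ Finset.range (b + 1), (b.choose k : ℝ) *
        (consSum x ^ (b - k)) (fun s => (consSum s ^ m) F 0) 0) +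
      ∑ k ∈ Finset.range (b + 1), (b.choose k : ℝ) *
        (consSum x ^ (b - k)) (fun s => hitSum m F v k s) 0 := by
  have := consSum_pow_nsmul_add_apply x v 1 b (fun s => (consSum s ^ m) F 0)
  rw [one_smul, Multiset.singleton_add] at this
  rw [this, ← Finset.sum_add_distrib]
  refine Finset.sum_congr rfl fun k _ => ?_
  rw [← mul_add, Nat.cast_one, one_pow, one_mul, consSum_pow_eq_zero_shift]
  congr 1
  rw [← Pi.add_apply, ← map_add]
  refine congrFun (congrArg _ (funext fun s => ?_)) 0
  rw [add_comm s, consSum_pow_eq_add_hitSum, Pi.add_apply]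

theorem GroupStable.consSum_cons_pow_consSum_pow_div_le (hF : GroupStable α δ m F) (hα : 1 ≤ α)
    (hδ : ∀ u, 0 ≤ δ u) (hF0 : ∀ Y, 0 ≤ F Y) (hF1 : ∀ Y, F Y ≤ 1) (v v' : U)
    (x : Multiset U) {n b : ℕ} (hn : n = Multiset.card x + 1) (hb : 0 < b) :
    (consSum (v ::ₘ x) ^ b) (fun s => (consSum s ^ m) F 0) 0 / ((n : ℝ) ^ b * (b : ℝ) ^ m) ≤
      (1 + (∑ k ∈ Finset.range (b + 1), (b.choose k : ℝ) * (Multiset.card x : ℝ) ^ (b - k) *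
          hitWeight m (fun _ => 1) k (b - k)) / ((n : ℝ) ^ b * (b : ℝ) ^ m) * (α - 1)) *
        ((consSum (v' ::ₘ x) ^ b) (fun s => (consSum s ^ m) F 0) 0 /
          ((n : ℝ) ^ b * (b : ℝ) ^ m)) +
      (∑ k ∈ Finset.range (b + 1), (b.choose k : ℝ) * (Multiset.card x : ℝ) ^ (b - k) *
          hitWeight m δ k (b - k)) / ((n : ℝ) ^ b * (b : ℝ) ^ m) := by
  have hW : ∀ k, 0 ≤ hitWeight m (fun _ => 1) k (b - k) :=
    fun k => hitWeight_nonneg (fun _ => zero_le_one) _ _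
  have hWe : ∀ k ≤ b, hitWeight m (fun _ => 1) k (b - k) =
      (b : ℝ) ^ m - ((b - k : ℕ) : ℝ) ^ m := by
    intro k hk
    have := add_hitWeight_one m k (b - k)
    rw [Nat.cast_sub hk] at this ⊢
    rw [add_sub_cancel] at this
    linarith
  have hn0 : 0 < n := by omega
  rw [consSum_cons_pow_consSum_pow, consSum_cons_pow_consSum_pow]
  set c : ℝ := (Multiset.card x : ℝ) with hc
  have hc0 : 0 ≤ c := by positivity
  refine div_le_of_jointConvexity
    (C := ∑ k ∈ Finset.range (b + 1), (b.choose k : ℝ) * c ^ (b - k) * ((b - k : ℕ) : ℝ) ^ m)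
    hα (by positivity) ?_
    (Finset.sum_nonneg fun k _ => mul_nonneg (by positivity) (hW k)) ?_ ?_
  · have e : (n : ℝ) ^ b = (1 + c) ^ b := by rw [hn, hc]; push_cast; ring
    rw [e, add_pow, Finset.sum_mul, ← Finset.sum_add_distrib]
    refine Finset.sum_congr rfl fun k hk => ?_
    rw [hWe k (Nat.lt_succ_iff.1 (Finset.mem_range.1 hk))]
    ring
  · rw [Finset.mul_sum, ← Finset.sum_add_distrib]
    refine Finset.sum_le_sum fun k _ => ?_
    rw [mul_left_comm, mul_assoc, ← mul_add, hc, ← consSum_pow_const x (b - k) _ 0,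
      ← consSum_pow_mul_left x (b - k) α, ← Pi.add_apply, ← map_add]
    refine mul_le_mul_of_nonneg_left (consSum_pow_mono fun s hs _ => ?_) (by positivity)
    have := hF.hitSum_le v v' k s
    rw [hs] at this
    simpa using this
  -- Up to a common factor the weights at `k` are `b ^ m - (b - k) ^ m` for a hit and `(b - k) ^ m`
  -- for a miss, and their ratio grows with `k`.
  · have main := sum_mul_sum_le_of_likelihoodRatio (N := b)
      (h := fun k => (b.choose k : ℝ) * (consSum x ^ (b - k))
        (fun s => hitSum m F v k s - hitWeight m δ k (b - k)) 0)
      (r := fun k => (b.choose k : ℝ) * c ^ (b - k) * hitWeight m (fun _ => 1) k (b - k))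
      (ρ := fun k => (b.choose k : ℝ) * c ^ (b - k) * ((b - k : ℕ) : ℝ) ^ m)
      (g := fun k => (b.choose k : ℝ) * (α *
        (consSum x ^ (b - k)) (fun s => (consSum s ^ m) F 0) 0))
      ?_ ?_ ?_ ?_ ?_ ?_
    · convert main using 2
      · rw [← Finset.sum_sub_distrib]
        refine Finset.sum_congr rfl fun k _ => ?_
        rw [mul_assoc, ← mul_sub, hc, ← consSum_pow_const x (b - k) _ 0, ← Pi.sub_apply,
          ← map_sub]
        rfl
      · rw [Finset.mul_sum]
        exact Finset.sum_congr rfl fun k _ => by ring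
    · exact fun k _ => mul_nonneg (by positivity) (hW k)
    · exact fun k _ => by positivity
    · intro k l hkl hlb
      rw [hWe k (by omega), hWe l hlb]
      have h1 : ((b - l : ℕ) : ℝ) ^ m ≤ ((b - k : ℕ) : ℝ) ^ m :=
        pow_le_pow_left₀ (by positivity) (by exact_mod_cast (by omega : b - l ≤ b - k)) _
      have := mul_le_mul_of_nonneg_left h1 (by positivity : 0 ≤ (b.choose k : ℝ) * c ^ (b - k) *
        ((b.choose l : ℝ) * c ^ (b - l)) * (b : ℝ) ^ m)
      linarith
    · intro l k hlk hkb
      -- A hit with `k` copies is compared with a miss with `l ≤ k` copies: `b - k` first-stage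
      -- draws are shared, and the other `k - l` form the replacement `r`. The `l` copies left over
      -- are never drawn in a miss.
      have step : c ^ (k - l) * ((b - l : ℕ) : ℝ) ^ m * (consSum x ^ (b - k))
          (fun s => hitSum m F v k s - hitWeight m δ k (b - k)) 0 ≤
          hitWeight m (fun _ => 1) k (b - k) * (α *
            (consSum x ^ (b - l)) (fun s => (consSum s ^ m) F 0) 0) := by
        have hsplit : b - l = (b - k) + (k - l) := by omega
        nth_rw 2 [hsplit]
        rw [pow_add, Module.End.mul_apply, ← consSum_pow_mul_left, ← consSum_pow_mul_left,
          ← consSum_pow_mul_left]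
        refine consSum_pow_mono fun s hs _ => ?_
        rw [add_zero, mul_assoc, hc, ← consSum_pow_const x (k - l) _ s, ← consSum_pow_mul_left,
          ← consSum_pow_mul_left]
        refine consSum_pow_mono fun r hr _ => ?_
        have := hF.hitSum_mul_le (by linarith) hδ hF0 hF1 v k s r (by omega)
        rw [hs, hr, ← Nat.cast_add, (by omega : k - l + (b - k) = b - l)] at this
        linarith
      have e : c ^ (b - l) = c ^ (b - k) * c ^ (k - l) := by
        rw [← pow_add]; congr 1; omega
      rw [e]
      have := mul_le_mul_of_nonneg_left step (by positivity : 0 ≤ (b.choose k : ℝ) *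
        (b.choose l : ℝ) * c ^ (b - k))
      linarith
    · intro k _ hz
      refine le_of_le_of_eq ?_ hz
      rw [mul_assoc, hc, ← consSum_pow_const x (b - k) _ 0]
      refine mul_le_mul_of_nonneg_left (consSum_pow_mono fun s hs _ => ?_) (by positivity)
      have h1 := hitSum_le_hitWeight (m := m) hF1 v k s
      have h2 := hitWeight_nonneg (m := m) hδ k (b - k)
      rw [hs] at h1
      rw [add_zero]
      linarith
    · exact fun k _ _ => mul_nonneg (by positivity) (mul_nonneg (by linarith)
        (consSum_pow_nonneg (fun s => consSum_pow_nonneg hF0 0) 0))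

end WithThenWith

/-! ### MUSTwo. -/

section WithThenWithout

/-- Any `m` of `b` independent draws are again independent draws, while the other `b - m` are free.
So MUSTwo has the law of `m` draws with replacement from `X`. -/
theorem consSum_pow_sum_powersetCard (x : Multiset U) (Φ : Multiset U → ℝ) (b m : ℕ) :
    (consSum x ^ b) (fun Y => ((Y.powersetCard m).map Φ).sum) 0 =
      (b.choose m : ℝ) * (Multiset.card x : ℝ) ^ (b - m) * (consSum x ^ m) Φ 0 := by
  induction b generalizing m Φ with
  | zero =>
    cases m <;> simp [Multiset.powersetCard_zero_right]
  | succ b ih =>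
    rw [consSum_pow_succ_apply]
    cases m with
    | zero =>
      have := consSum_pow_const x b (Φ 0)
      simp only [Multiset.powersetCard_zero_left, Multiset.map_singleton, Multiset.sum_singleton,
        this]
      simp
      ring
    | succ m =>
      have e : ∀ a, (consSum x ^ b) (fun Y => ((Y.powersetCard (m + 1)).map Φ).sum) (a ::ₘ 0) =
          (consSum x ^ b) (fun Y => ((Y.powersetCard (m + 1)).map Φ).sum) 0 +
          (consSum x ^ b) (fun Y => ((Y.powersetCard m).map fun s => Φ (a ::ₘ s)).sum) 0 := by
        intro a
        rw [consSum_pow_eq_zero_shift, ← Pi.add_apply, ← map_add]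
        refine congrFun (congrArg _ (funext fun Y => ?_)) 0
        rw [Pi.add_apply, add_comm Y, Multiset.cons_add, zero_add, Multiset.powersetCard_cons,
          Multiset.map_add, Multiset.sum_add, Multiset.map_map]
        rfl
      simp_rw [e, Multiset.sum_map_add, ih, Multiset.sum_map_mul_left]
      have e2 : (x.map fun a => (consSum x ^ m) (fun s => Φ (a ::ₘ s)) 0).sum =
          (consSum x ^ (m + 1)) Φ 0 := by
        rw [consSum_pow_succ_apply]
        congr 1
        refine Multiset.map_congr rfl fun a _ => ?_
        rw [consSum_pow_eq_zero_shift x m Φ (a ::ₘ 0)]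
        refine congrFun (congrArg _ (funext fun s => ?_)) 0
        rw [add_comm s, Multiset.cons_add, zero_add]
      rw [e2, Nat.choose_succ_succ, Nat.add_sub_add_right]
      simp only [Multiset.map_const', Multiset.sum_replicate, nsmul_eq_mul]
      -- For `b < m + 1` the truncated exponent `b - (m + 1)` is harmless, since its binomial
      -- coefficient is zero.
      rcases Nat.lt_or_ge b (m + 1) with h | h
      · rw [Nat.choose_eq_zero_of_lt h]
        push_cast
        ring
      · have : b - m = (b - (m + 1)) + 1 := by omega
        rw [this, pow_succ]
        push_cast
        ring

end WithThenWithout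

end Amplification

/-! ### Expectations under the sampling schemes. -/

section Expectation

variable {U : Type*}

theorem tsum_bind_mul {A B : Type*} (p : PMF A) (q : A → PMF B) (g : B → ENNReal) :
    ∑' y, (p.bind q) y * g y = ∑' a, p a * ∑' y, q a y * g y := by
  simp_rw [PMF.bind_apply, ← ENNReal.tsum_mul_right, ← ENNReal.tsum_mul_left]
  rw [ENNReal.tsum_comm]
  simp_rw [mul_assoc]

theorem tsum_pure_mul {A : Type*} (a : A) (g : A → ENNReal) :
    ∑' y, (PMF.pure a) y * g y = g a := by
  rw [tsum_eq_single a]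
  · simp
  · intro b hb
    simp [hb]

theorem tsum_map_mul {A B : Type*} (p : PMF A) (f : A → B) (g : B → ENNReal) :
    ∑' y, (p.map f) y * g y = ∑' a, p a * g (f a) := by
  rw [PMF.map, tsum_bind_mul]
  simp only [Function.comp_apply, tsum_pure_mul]

theorem tsum_ofMultiset_mul {A : Type*} (s : Multiset A) (hs : s ≠ 0) (f : A → ℝ)
    (hf : ∀ a ∈ s, 0 ≤ f a) :
    ∑' a, PMF.ofMultiset s hs a * ENNReal.ofReal (f a) =
      ENNReal.ofReal ((s.map f).sum / Multiset.card s) := by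
  classical
  have hc : 0 < (Multiset.card s : ℝ) := by exact_mod_cast Multiset.card_pos.2 hs
  rw [tsum_eq_sum (s := s.toFinset)]
  · rw [Finset.sum_multiset_map_count, Finset.sum_div,
      ENNReal.ofReal_sum_of_nonneg fun a ha => ?_]
    · refine Finset.sum_congr rfl fun a ha => ?_
      rw [PMF.ofMultiset_apply, nsmul_eq_mul, mul_div_right_comm,
        ENNReal.ofReal_mul (by positivity), ENNReal.ofReal_div_of_pos hc, ENNReal.ofReal_natCast,
        ENNReal.ofReal_natCast]
    · exact div_nonneg (nsmul_nonneg (hf a (Multiset.mem_toFinset.1 ha)) _) hc.le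
  · intro a ha
    rw [PMF.ofMultiset_apply, Multiset.count_eq_zero_of_notMem fun h =>
      ha (Multiset.mem_toFinset.2 h)]
    simp

/-- `p` is the law of a random dataset under which every nonnegative `f` has expectation
`E f`. -/
def HasExpectation {k : ℕ} (p : PMF (Sym U k)) (E : (Multiset U → ℝ) → ℝ) : Prop :=
  ∀ f : Multiset U → ℝ, (∀ Y, 0 ≤ f Y) →
    0 ≤ E f ∧ ∑' Y, p Y * ENNReal.ofReal (f Y) = ENNReal.ofReal (E f)

theorem hasExpectation_sampleWR {n : ℕ} (hn : 0 < n) (X : Sym U n) (k : ℕ) :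
    HasExpectation (sampleWR hn X k)
      fun f => (consSum (X : Multiset U) ^ k) f 0 / (n : ℝ) ^ k := by
  intro f hf
  refine ⟨div_nonneg (consSum_pow_nonneg hf 0) (by positivity), ?_⟩
  induction k generalizing f with
  | zero =>
    rw [sampleWR, tsum_pure_mul]
    simp
  | succ k ih =>
    rw [sampleWR, tsum_bind_mul]
    have e : ∀ a, ∑' Y, ((sampleWR hn X k).map fun Y => a ::ₛ Y) Y *
        ENNReal.ofReal (f (Y : Multiset U)) =
        ENNReal.ofReal ((consSum (X : Multiset U) ^ k) f (a ::ₘ 0) / (n : ℝ) ^ k) := by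
      intro a
      rw [tsum_map_mul, consSum_pow_eq_zero_shift, ← ih _ fun Y => hf _]
      simp only [Sym.coe_cons, add_comm _ (a ::ₘ (0 : Multiset U)), Multiset.cons_add, zero_add]
    simp_rw [e]
    rw [tsum_ofMultiset_mul _ _ _ fun a _ =>
      div_nonneg (consSum_pow_nonneg hf _) (by positivity)]
    have hc : Multiset.card (X : Multiset U) = n := X.2
    rw [hc, consSum_pow_succ_apply, pow_succ, ← div_div]
    simp only [div_eq_mul_inv, Multiset.sum_map_mul_right]

theorem hasExpectation_sampleWOR {n k : ℕ} (hk : k ≤ n) (X : Sym U n) :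
    HasExpectation (sampleWOR hk X)
      fun f => (((X : Multiset U).powersetCard k).map f).sum / (n.choose k : ℝ) := by
  intro f hf
  have hc : Multiset.card (X : Multiset U) = n := X.2
  refine ⟨div_nonneg (Multiset.sum_nonneg fun y hy => ?_) (by positivity), ?_⟩
  · obtain ⟨Y, _, rfl⟩ := Multiset.mem_map.1 hy
    exact hf Y
  rw [sampleWOR, tsum_ofMultiset_mul _ _ (fun Y : Sym U k => f Y) fun Y _ => hf _]
  have e1 : (subDatasets k X).map (fun Y : Sym U k => f (Y : Multiset U)) =
      ((X : Multiset U).powersetCard k).map f := by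
    rw [subDatasets, Multiset.map_pmap]
    exact Multiset.pmap_eq_map _ f _ _
  have e2 : Multiset.card (subDatasets k X) = n.choose k := by
    rw [subDatasets, Multiset.card_pmap, Multiset.card_powersetCard, hc]
  rw [e1, e2]

theorem HasExpectation.bind {k l : ℕ} {p : PMF (Sym U k)} {q : Sym U k → PMF (Sym U l)}
    {E : (Multiset U → ℝ) → ℝ} {E' : Multiset U → (Multiset U → ℝ) → ℝ}
    (hp : HasExpectation p E) (hq : ∀ Y : Sym U k, HasExpectation (q Y) (E' Y))
    (hE' : ∀ f : Multiset U → ℝ, (∀ Y, 0 ≤ f Y) → ∀ Y, 0 ≤ E' Y f) :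
    HasExpectation (p.bind q) fun f => E fun Y => E' Y f := by
  intro f hf
  obtain ⟨h1, h2⟩ := hp (fun Y => E' Y f) (hE' f hf)
  refine ⟨h1, ?_⟩
  rw [tsum_bind_mul, ← h2]
  simp_rw [(hq _ f hf).2]

theorem HasExpectation.congr {k : ℕ} {p : PMF (Sym U k)} {E E' : (Multiset U → ℝ) → ℝ}
    (hp : HasExpectation p E) (h : ∀ f, E f = E' f) : HasExpectation p E' := by
  rwa [← funext h]

theorem hasExpectation_mustOW {n b : ℕ} (m : ℕ) (hb : 0 < b) (hbn : b < n) (X : Sym U n) :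
    HasExpectation (mustOW m hb hbn X) fun f =>
      (((X : Multiset U).powersetCard b).map fun s => (consSum s ^ m) f 0).sum /
        ((n.choose b : ℝ) * (b : ℝ) ^ m) := by
  refine ((hasExpectation_sampleWOR hbn.le X).bind
    (E' := fun Y f => (consSum Y ^ m) f 0 / (b : ℝ) ^ m)
    (fun Y => hasExpectation_sampleWR hb Y m)
    fun f hf Y => div_nonneg (consSum_pow_nonneg hf 0) (by positivity)).congr fun f => ?_
  rw [mul_comm (n.choose b : ℝ), ← div_div]
  simp only [div_eq_mul_inv, Multiset.sum_map_mul_right]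

theorem hasExpectation_mustWW {n b : ℕ} (m : ℕ) (hn : 0 < n) (hb : 0 < b) (X : Sym U n) :
    HasExpectation (mustWW m hn hb X) fun f =>
      (consSum (X : Multiset U) ^ b) (fun s => (consSum s ^ m) f 0) 0 /
        ((n : ℝ) ^ b * (b : ℝ) ^ m) := by
  refine ((hasExpectation_sampleWR hn X b).bind
    (E' := fun Y f => (consSum Y ^ m) f 0 / (b : ℝ) ^ m)
    (fun Y => hasExpectation_sampleWR hb Y m)
    fun f hf Y => div_nonneg (consSum_pow_nonneg hf 0) (by positivity)).congr fun f => ?_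
  simp only [div_eq_inv_mul, consSum_pow_mul_left]
  field_simp

theorem hasExpectation_mustWO {n b m : ℕ} (hn : 0 < n) (hmb : m < b) (X : Sym U n) :
    HasExpectation (mustWO hn hmb X) fun f =>
      (consSum (X : Multiset U) ^ m) f 0 / (n : ℝ) ^ m := by
  refine ((hasExpectation_sampleWR hn X b).bind
    (E' := fun Y f => ((Y.powersetCard m).map f).sum / (b.choose m : ℝ))
    (fun Y => hasExpectation_sampleWOR hmb.le Y)
    fun f hf Y => div_nonneg (Multiset.sum_nonneg fun y hy => ?_) (by positivity)).congr
      fun f => ?_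
  · obtain ⟨Y, _, rfl⟩ := Multiset.mem_map.1 hy
    exact hf Y
  have hc : Multiset.card (X : Multiset U) = n := X.2
  have hpos : 0 < b.choose m := Nat.choose_pos hmb.le
  simp only [div_eq_inv_mul, consSum_pow_mul_left]
  rw [consSum_pow_sum_powersetCard, hc]
  have : (n : ℝ) ^ b = (n : ℝ) ^ (b - m) * (n : ℝ) ^ m := by
    rw [← pow_add]; congr 1; omega
  rw [this]
  field_simp

theorem HasExpectation.countProb_eq [DecidableEq U] {k : ℕ} {p : PMF (Sym U k)}
    {E : (Multiset U → ℝ) → ℝ} (hp : HasExpectation p E) (v : U) (u : ℕ) :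
    countProb p v u = E fun Y => if Y.count v = u then 1 else 0 := by
  obtain ⟨h1, h2⟩ := hp (fun Y => if Y.count v = u then 1 else 0)
    fun Y => by split_ifs <;> norm_num
  rw [countProb, PMF.toOuterMeasure_apply, ← ENNReal.toReal_ofReal h1, ← h2]
  congr 1
  refine tsum_congr fun Y => ?_
  by_cases h : (Y : Multiset U).count v = u <;> simp [h, Set.indicator]

theorem HasExpectation.appearProb_eq [DecidableEq U] {k : ℕ} {p : PMF (Sym U k)}
    {E : (Multiset U → ℝ) → ℝ} (hp : HasExpectation p E) (v : U) :
    appearProb p v = E fun Y => if Y.count v = 0 then 0 else 1 := by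
  obtain ⟨h1, h2⟩ := hp (fun Y => if Y.count v = 0 then 0 else 1)
    fun Y => by split_ifs <;> norm_num
  rw [appearProb, PMF.toOuterMeasure_apply, ← ENNReal.toReal_ofReal h1, ← h2]
  congr 1
  refine tsum_congr fun Y => ?_
  by_cases h : v ∈ (Y : Multiset U)
  · have : (Y : Multiset U).count v ≠ 0 := Multiset.count_ne_zero.2 h
    simp [Sym.mem_coe.1 h, this, Set.indicator]
  · simp [mt Sym.mem_coe.2 h, Set.indicator]

/-- The function `f` on datasets of size `m`, extended by `0`. -/
noncomputable def extendZero {m : ℕ} (f : Sym U m → ℝ) (Y : Multiset U) : ℝ :=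
  open Classical in if h : Multiset.card Y = m then f ⟨Y, h⟩ else 0

theorem extendZero_coe {m : ℕ} (f : Sym U m → ℝ) (Y : Sym U m) :
    extendZero f (Y : Multiset U) = f Y := by
  have : Multiset.card (Y : Multiset U) = m := Y.2
  rw [extendZero, dif_pos this]
  rfl

end Expectation

/-! ### Group privacy profile and reduction of privacy to expectations. -/

section Profile

variable {U Z : Type*} [MeasurableSpace Z] {m : ℕ}

theorem HasExpectation.subsampled_real {C : Type*} {S : C → PMF (Sym U m)} {X : C}
    {E : (Multiset U → ℝ) → ℝ} (hp : HasExpectation (S X) E)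
    (M : Sym U m → ProbabilityMeasure Z) {O : Set Z} (hO : MeasurableSet O) :
    (subsampled M S X : Measure Z).real O =
      E (extendZero fun Y => (M Y : Measure Z).real O) := by
  obtain ⟨h1, h2⟩ := hp (extendZero fun Y => (M Y : Measure Z).real O) fun Y => by
    rw [extendZero]; split_ifs <;> simp
  rw [← ENNReal.toReal_ofReal h1, ← h2, Measure.real]
  congr 1
  change (Measure.sum fun Y => S X Y • (M Y : Measure Z)) O = _
  rw [Measure.sum_apply _ hO]
  refine tsum_congr fun Y => ?_
  rw [extendZero_coe, Measure.smul_apply, smul_eq_mul, ofReal_measureReal]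

/-- The bound by `1` ensures that the real `sSup` in `alphaDiv`, and then in `groupProfile`, is a
true supremum and not the default value `0`. -/
theorem bddAbove_alphaDiv {α : ℝ} (hα : 0 ≤ α) (μ ν : ProbabilityMeasure Z) :
    ∀ r ∈ {r : ℝ | ∃ O : Set Z, MeasurableSet O ∧
      r = (μ : Measure Z).real O - α * (ν : Measure Z).real O}, r ≤ 1 := by
  rintro r ⟨O, _, rfl⟩
  have h1 : (μ : Measure Z).real O ≤ 1 := measureReal_le_one
  have h2 : 0 ≤ α * (ν : Measure Z).real O := by positivity
  linarith

theorem alphaDiv_nonneg {α : ℝ} (hα : 0 ≤ α) (μ ν : ProbabilityMeasure Z) :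
    0 ≤ alphaDiv α μ ν :=
  le_csSup ⟨1, bddAbove_alphaDiv hα μ ν⟩ ⟨∅, MeasurableSet.empty, by simp⟩

theorem alphaDiv_le_one {α : ℝ} (hα : 0 ≤ α) (μ ν : ProbabilityMeasure Z) :
    alphaDiv α μ ν ≤ 1 :=
  csSup_le ⟨0, ∅, MeasurableSet.empty, by simp⟩ (bddAbove_alphaDiv hα μ ν)

variable [DecidableEq U]

theorem groupProfile_nonneg (M : Sym U m → ProbabilityMeasure Z) (ε : ℝ) (j : ℕ) :
    0 ≤ groupProfile M ε j := by
  refine Real.sSup_nonneg ?_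
  rintro r ⟨X, X', _, rfl⟩
  exact alphaDiv_nonneg (Real.exp_pos ε).le _ _

theorem real_le_exp_mul_add_groupProfile (M : Sym U m → ProbabilityMeasure Z) (ε : ℝ) {j : ℕ}
    {X X' : Sym U m} (h : substDist X X' ≤ j) {O : Set Z} (hO : MeasurableSet O) :
    (M X : Measure Z).real O ≤
      Real.exp ε * (M X' : Measure Z).real O + groupProfile M ε j := by
  have hα := (Real.exp_pos ε).le
  have h1 : (M X : Measure Z).real O - Real.exp ε * (M X' : Measure Z).real O ≤
      alphaDiv (Real.exp ε) (M X) (M X') :=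
    le_csSup ⟨1, bddAbove_alphaDiv hα _ _⟩ ⟨O, hO, rfl⟩
  have h2 : alphaDiv (Real.exp ε) (M X) (M X') ≤ groupProfile M ε j := by
    refine le_csSup ⟨1, ?_⟩ ⟨X, X', h, rfl⟩
    rintro r ⟨Y, Y', _, rfl⟩
    exact alphaDiv_le_one hα _ _
  linarith

theorem groupStable_extendZero (M : Sym U m → ProbabilityMeasure Z) (ε : ℝ) {O : Set Z}
    (hO : MeasurableSet O) :
    GroupStable (Real.exp ε) (groupProfile M ε) m
      (extendZero fun Y => (M Y : Measure Z).real O) := by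
  intro A R Y hAR _ hAY
  have h1 : Multiset.card (A + Y) = m := by rw [Multiset.card_add, hAY]
  have h2 : Multiset.card (R + Y) = m := by rw [Multiset.card_add, ← hAR, hAY]
  rw [extendZero, extendZero, dif_pos h1, dif_pos h2]
  refine real_le_exp_mul_add_groupProfile M ε ?_ hO
  change Multiset.card ((A + Y) - (R + Y)) ≤ _
  -- The common part `Y` cancels, leaving `A - R ≤ A`; the distance is at most `card A`, with
  -- equality not needed.
  rw [add_tsub_add_eq_tsub_right]
  exact Multiset.card_le_card tsub_le_self

/-- Privacy of a subsampled mechanism from an inequality between expectations. -/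
theorem isDP_subsampled {n : ℕ} {S : Sym U n → PMF (Sym U m)}
    {E : Multiset U → (Multiset U → ℝ) → ℝ} (hS : ∀ X : Sym U n, HasExpectation (S X) (E X))
    (M : Sym U m → ProbabilityMeasure Z) {ε η δ' : ℝ} (hε : 0 < ε) (hη : 0 ≤ η)
    (h : ∀ (F : Multiset U → ℝ), GroupStable (Real.exp ε) (groupProfile M ε) m F →
      (∀ Y, 0 ≤ F Y) → (∀ Y, F Y ≤ 1) → ∀ (v v' : U) (x : Multiset U), n = Multiset.card x + 1 →
      E (v ::ₘ x) F ≤ (1 + η * (Real.exp ε - 1)) * E (v' ::ₘ x) F + δ') :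
    IsDP (subsampled M S) (epsAmp η ε) δ' := by
  rintro X X' ⟨x, v, v', _, hX, hX'⟩ O hO
  rw [(hS X).subsampled_real M hO, (hS X').subsampled_real M hO, epsAmp, Real.exp_log, hX, hX']
  · refine h _ (groupStable_extendZero M ε hO) (fun Y => ?_) (fun Y => ?_) v v' x ?_
    · rw [extendZero]; split_ifs <;> simp
    · rw [extendZero]; split_ifs
      · exact measureReal_le_one
      · exact zero_le_one
    · have h1 : Multiset.card (X : Multiset U) = n := X.2
      rw [← h1, hX, Multiset.card_cons]
  · have := Real.one_lt_exp_iff.2 hε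
    have : 0 ≤ η * (Real.exp ε - 1) := mul_nonneg hη (by linarith)
    linarith

end Profile

/-! ### Closed forms for `η` and `δ'`, and bounds on `η`. -/

section Combinatorics

/-- Both sides count the pairs of a `j`-subset and an `m`-subset of a `b`-set that meet in `u`
elements. -/
theorem choose_mul_choose_mul_choose {b m j u : ℕ} (hmb : m ≤ b) (hum : u ≤ m) (huj : u ≤ j)
    (hjb : j ≤ b) :
    b.choose j * j.choose u * (b - j).choose (m - u) =
      b.choose m * m.choose u * (b - m).choose (j - u) := by
  rw [Nat.choose_mul huj, Nat.choose_mul hum, mul_assoc, mul_assoc]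
  congr 1
  obtain ⟨i, rfl⟩ := Nat.exists_eq_add_of_le huj
  obtain ⟨l, rfl⟩ := Nat.exists_eq_add_of_le hum
  obtain ⟨B, rfl⟩ := Nat.exists_eq_add_of_le (hum.trans hmb)
  rw [Nat.add_sub_cancel_left, Nat.add_sub_cancel_left, Nat.add_sub_cancel_left,
    Nat.add_sub_add_left, Nat.add_sub_add_left]
  rcases Nat.lt_or_ge B (l + i) with h | h
  · rw [Nat.choose_eq_zero_of_lt (by omega : B - i < l),
      Nat.choose_eq_zero_of_lt (by omega : B - l < i), mul_zero, mul_zero]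
  · have h1 := Nat.choose_mul (n := B) (k := l + i) (s := i) (by omega)
    have h2 := Nat.choose_mul (n := B) (k := l + i) (s := l) (by omega)
    rw [Nat.add_sub_cancel] at h1
    rw [Nat.add_sub_cancel_left] at h2
    rw [← h1, ← h2, Nat.choose_symm_add]

/-- Binomial thinning followed by hypergeometric sampling is binomial sampling. -/
theorem sum_binomial_mul_hypergeometric {p q : ℝ} (hpq : p + q = 1) {b m u : ℕ} (hmb : m ≤ b)
    (hum : u ≤ m) :
    ∑ j ∈ Finset.range (b + 1), (b.choose j : ℝ) * p ^ j * q ^ (b - j) *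
        ((j.choose u : ℝ) * ((b - j).choose (m - u) : ℝ) / (b.choose m : ℝ)) =
      (m.choose u : ℝ) * p ^ u * q ^ (m - u) := by
  have hpos : 0 < b.choose m := Nat.choose_pos hmb
  have hterm : ∀ i ∈ Finset.range (b - u + 1),
      (b.choose (u + i) : ℝ) * p ^ (u + i) * q ^ (b - (u + i)) *
        (((u + i).choose u : ℝ) * ((b - (u + i)).choose (m - u) : ℝ) / (b.choose m : ℝ)) =
      ((m.choose u : ℝ) * p ^ u) * (((b - m).choose i : ℝ) * p ^ i * q ^ (b - (u + i))) := by
    intro i hi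
    have hi' := Finset.mem_range.1 hi
    have h := choose_mul_choose_mul_choose (b := b) (m := m) (j := u + i) (u := u) hmb hum
      (by omega) (by omega)
    rw [Nat.add_sub_cancel_left] at h
    have h' : (b.choose (u + i) : ℝ) * ((u + i).choose u : ℝ) *
        ((b - (u + i)).choose (m - u) : ℝ) =
        (b.choose m : ℝ) * (m.choose u : ℝ) * ((b - m).choose i : ℝ) := by exact_mod_cast h
    rw [pow_add]
    field_simp
    linear_combination (p ^ u * p ^ i * q ^ (b - (u + i))) * h'
  -- Terms with `j < u` vanish, so `j = u + i`. Those with `i > b - m` vanish too, and the rest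
  -- expands `(p + q) ^ (b - m) = 1`.
  have hsplit : b + 1 = u + (b - u + 1) := by omega
  rw [hsplit, Finset.sum_range_add, Finset.sum_eq_zero, zero_add, Finset.sum_congr rfl hterm,
    ← Finset.mul_sum]
  · have hsplit' : b - u + 1 = (b - m + 1) + (m - u) := by omega
    have hz : ∑ i ∈ Finset.range (m - u), ((b - m).choose (b - m + 1 + i) : ℝ) *
        p ^ (b - m + 1 + i) * q ^ (b - (u + (b - m + 1 + i))) = 0 := by
      refine Finset.sum_eq_zero fun i _ => ?_
      rw [Nat.choose_eq_zero_of_lt (by omega)]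
      simp
    rw [hsplit', Finset.sum_range_add, hz, add_zero]
    have hs : ∑ i ∈ Finset.range (b - m + 1), ((b - m).choose i : ℝ) * p ^ i *
        q ^ (b - (u + i)) = q ^ (m - u) * (p + q) ^ (b - m) := by
      rw [add_pow, Finset.mul_sum]
      refine Finset.sum_congr rfl fun i hi => ?_
      have hi' := Finset.mem_range.1 hi
      have : b - (u + i) = (m - u) + (b - m - i) := by omega
      rw [this, pow_add]
      ring
    rw [hs, hpq, one_pow, mul_one]
  · intro j hj
    rw [Nat.choose_eq_zero_of_lt (Finset.mem_range.1 hj)]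
    simp

theorem div_pow_mul_one_sub_div_pow {n k c u m : ℕ} (hn : 0 < n) (hc : n = k + c) (hum : u ≤ m) :
    ((k : ℝ) / n) ^ u * (1 - (k : ℝ) / n) ^ (m - u) =
      (k : ℝ) ^ u * (c : ℝ) ^ (m - u) / (n : ℝ) ^ m := by
  have e : 1 - (k : ℝ) / n = c / n := by
    rw [hc] at hn ⊢
    field_simp
    push_cast
    ring
  have e2 : (n : ℝ) ^ m = (n : ℝ) ^ u * (n : ℝ) ^ (m - u) := by
    rw [← pow_add]; congr 1; omega
  rw [e, e2, div_pow, div_pow]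
  field_simp

theorem hitWeight_div_eq_sum {m n k c : ℕ} (δ : ℕ → ℝ) (hn : 0 < n) (hc : n = k + c) :
    hitWeight m δ k c / (n : ℝ) ^ m = ∑ u ∈ Finset.Icc 1 m,
      (m.choose u : ℝ) * ((k : ℝ) / n) ^ u * (1 - (k : ℝ) / n) ^ (m - u) * δ u := by
  rw [hitWeight, Finset.sum_div]
  refine Finset.sum_congr rfl fun u hu => ?_
  rw [mul_assoc (m.choose u : ℝ) (((k : ℝ) / n) ^ u),
    div_pow_mul_one_sub_div_pow hn hc (Finset.mem_Icc.1 hu).2]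
  ring

theorem hitWeight_one_div {m n k c : ℕ} (hn : 0 < n) (hc : n = k + c) :
    hitWeight m (fun _ => 1) k c / (n : ℝ) ^ m = 1 - (1 - (k : ℝ) / n) ^ m := by
  have h := add_hitWeight_one m k c
  have e := div_pow_mul_one_sub_div_pow hn hc (Nat.zero_le m)
  simp only [pow_zero, one_mul, Nat.sub_zero] at e
  rw [e]
  have : ((k : ℝ) + c) = n := by rw [hc]; push_cast; ring
  rw [this] at h
  field_simp
  linarith

theorem sum_Icc_one_eq_sum_range (f : ℕ → ℝ) (m : ℕ) (h0 : f 0 = 0) :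
    ∑ j ∈ Finset.Icc 1 m, f j = ∑ j ∈ Finset.range (m + 1), f j := by
  rw [sum_range_succ_eq_add_sum_Icc, h0, zero_add]

theorem deltaWO_eq_sum {n b m : ℕ} (hmb : m < b) (δ : ℕ → ℝ) :
    deltaWO n b m δ = ∑ j ∈ Finset.Icc 1 m, (m.choose j : ℝ) * (1 / (n : ℝ)) ^ j *
      (1 - 1 / (n : ℝ)) ^ (m - j) * δ j := by
  set p : ℝ := 1 / (n : ℝ)
  -- The two ranges of `j` merge, because `j.choose u = 0` for `j < u ≤ m`.
  have e : deltaWO n b m δ = ∑ j ∈ Finset.Icc 1 b, (b.choose j : ℝ) * p ^ j * (1 - p) ^ (b - j) *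
      ∑ u ∈ Finset.Icc 1 m,
        (j.choose u : ℝ) * ((b - j).choose (m - u) : ℝ) / (b.choose m : ℝ) * δ u := by
    have hun : Finset.Icc 1 b = Finset.Icc 1 m ∪ Finset.Icc (m + 1) b := by
      ext j; simp only [Finset.mem_union, Finset.mem_Icc]; omega
    have hdis : Disjoint (Finset.Icc 1 m) (Finset.Icc (m + 1) b) := by
      rw [Finset.disjoint_left]
      intro j h1 h2
      simp only [Finset.mem_Icc] at h1 h2
      omega
    rw [hun, Finset.sum_union hdis, deltaWO]
    congr 1
    refine Finset.sum_congr rfl fun j hj => ?_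
    congr 1
    refine Finset.sum_subset (Finset.Icc_subset_Icc_right (Finset.mem_Icc.1 hj).2) ?_
    intro u hu hu'
    have : j < u := by
      simp only [Finset.mem_Icc] at hu hu'
      omega
    rw [Nat.choose_eq_zero_of_lt this]
    simp
  rw [e, sum_Icc_one_eq_sum_range]
  · simp_rw [Finset.mul_sum]
    rw [Finset.sum_comm]
    refine Finset.sum_congr rfl fun u hu => ?_
    rw [← sum_binomial_mul_hypergeometric (add_sub_cancel p 1) hmb.le (Finset.mem_Icc.1 hu).2,
      Finset.sum_mul]
    exact Finset.sum_congr rfl fun j _ => by ring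
  · rw [Finset.sum_eq_zero, mul_zero]
    intro u hu
    have : 0 < u := (Finset.mem_Icc.1 hu).1
    rw [Nat.choose_eq_zero_of_lt this]
    simp

theorem etaWO_eq {n b m : ℕ} (hmb : m < b) :
    etaWO n b m = 1 - (1 - 1 / (n : ℝ)) ^ m := by
  have hpos : 0 < b.choose m := Nat.choose_pos hmb.le
  rw [etaWO, sum_Icc_one_eq_sum_range]
  · set p : ℝ := 1 / (n : ℝ)
    simp_rw [mul_sub, Finset.sum_sub_distrib]
    -- The case `u = 0`: the probability that none of the `m` draws is `v`.
    have h0 := sum_binomial_mul_hypergeometric (add_sub_cancel p 1) hmb.le (Nat.zero_le m)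
    have h1 := add_pow p (1 - p) b
    rw [add_sub_cancel, one_pow] at h1
    simp only [Nat.choose_zero_right, Nat.cast_one, one_mul, Nat.sub_zero, pow_zero] at h0
    rw [h0]
    congr 1
    exact (Finset.sum_congr rfl fun j _ => by ring).trans h1.symm
  · rw [Nat.sub_zero, div_self (by positivity), sub_self, mul_zero]

/-- The quotient of `(n - 1).choose b` by `n.choose (b + 1)` is `(b + 1) / n`, the probability that
a given record is among those chosen. -/
theorem deltaOW_eq {n b m : ℕ} (hbn : b + 1 < n) (δ : ℕ → ℝ) :
    (((n - 1).choose b : ℝ) * hitWeight m δ 1 b) /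
      ((n.choose (b + 1) : ℝ) * ((b + 1 : ℕ) : ℝ) ^ m) =
    ((b + 1 : ℕ) : ℝ) / n * (hitWeight m δ 1 b / ((b + 1 : ℕ) : ℝ) ^ m) := by
  have hpos : 0 < n.choose (b + 1) := Nat.choose_pos hbn.le
  obtain ⟨c, rfl⟩ : ∃ c, n = c + 1 := ⟨n - 1, by omega⟩
  have h : ((c : ℝ) + 1) * (c.choose b : ℝ) = ((c + 1).choose (b + 1) : ℝ) * ((b : ℝ) + 1) := by
    exact_mod_cast Nat.add_one_mul_choose_eq c b
  rw [Nat.add_sub_cancel]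
  push_cast
  field_simp
  linear_combination hitWeight m δ 1 b * h

theorem sum_binomial_mul_hitWeight_div {n b m : ℕ} (hn : 0 < n) (hb : 0 < b) (δ : ℕ → ℝ) :
    (∑ k ∈ Finset.range (b + 1), (b.choose k : ℝ) * ((n - 1 : ℕ) : ℝ) ^ (b - k) *
      hitWeight m δ k (b - k)) / ((n : ℝ) ^ b * (b : ℝ) ^ m) =
    ∑ j ∈ Finset.Icc 1 b, (b.choose j : ℝ) * (1 / (n : ℝ)) ^ j * (1 - 1 / (n : ℝ)) ^ (b - j) *
      (hitWeight m δ j (b - j) / (b : ℝ) ^ m) := by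
  rw [sum_Icc_one_eq_sum_range, Finset.sum_div]
  · refine Finset.sum_congr rfl fun k hk => ?_
    have := div_pow_mul_one_sub_div_pow (n := n) (k := 1) (c := n - 1) hn (by omega)
      (Nat.lt_succ_iff.1 (Finset.mem_range.1 hk))
    rw [Nat.cast_one, one_pow, one_mul] at this
    rw [mul_assoc (b.choose k : ℝ) ((1 / (n : ℝ)) ^ k), this]
    field_simp
  · rw [hitWeight, Finset.sum_eq_zero, zero_div, mul_zero]
    intro u hu
    have : u ≠ 0 := (Nat.succ_le_iff.1 (Finset.mem_Icc.1 hu).1).ne'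
    simp [this]

theorem deltaWW_eq {n b m : ℕ} (hn : 0 < n) (hb : 0 < b) (δ : ℕ → ℝ) :
    deltaWW n b m δ = (∑ k ∈ Finset.range (b + 1), (b.choose k : ℝ) *
      ((n - 1 : ℕ) : ℝ) ^ (b - k) * hitWeight m δ k (b - k)) / ((n : ℝ) ^ b * (b : ℝ) ^ m) := by
  rw [sum_binomial_mul_hitWeight_div hn hb, deltaWW]
  refine Finset.sum_congr rfl fun j hj => ?_
  have := (Finset.mem_Icc.1 hj).2
  rw [hitWeight_div_eq_sum δ hb (by omega)]

theorem etaWW_eq {n b m : ℕ} (hn : 0 < n) (hb : 0 < b) :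
    etaWW n b m = (∑ k ∈ Finset.range (b + 1), (b.choose k : ℝ) *
      ((n - 1 : ℕ) : ℝ) ^ (b - k) * hitWeight m (fun _ => 1) k (b - k)) /
        ((n : ℝ) ^ b * (b : ℝ) ^ m) := by
  rw [sum_binomial_mul_hitWeight_div hn hb, etaWW]
  refine Finset.sum_congr rfl fun j hj => ?_
  have := (Finset.mem_Icc.1 hj).2
  rw [hitWeight_one_div hb (by omega)]

theorem one_sub_one_div_mem_Ioo {n : ℕ} (hn : 2 ≤ n) : 1 - 1 / (n : ℝ) ∈ Set.Ioo (0 : ℝ) 1 := by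
  have h2 : (2 : ℝ) ≤ n := by exact_mod_cast hn
  have h3 : 1 / (n : ℝ) < 1 := by rw [div_lt_one (by linarith)]; linarith
  have h4 : 0 < 1 / (n : ℝ) := by positivity
  exact ⟨by linarith, by linarith⟩

theorem one_sub_pow_mem_Ioo {n m : ℕ} (hn : 2 ≤ n) (hm : 0 < m) :
    1 - (1 - 1 / (n : ℝ)) ^ m ∈ Set.Ioo (0 : ℝ) 1 := by
  obtain ⟨h0, h1⟩ := one_sub_one_div_mem_Ioo hn
  have h2 := pow_lt_one₀ h0.le h1 hm.ne'
  have h3 := pow_pos h0 m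
  exact ⟨by linarith, by linarith⟩

theorem etaOW_mem_Ioo {n b m : ℕ} (hb : 0 < b) (hm : 0 < m) (hbn : b < n) :
    etaOW n b m ∈ Set.Ioo (0 : ℝ) 1 := by
  have hbn' : (b : ℝ) < n := by exact_mod_cast hbn
  have hb0 : (1 : ℝ) ≤ b := by exact_mod_cast hb
  have hq1 : 1 / (b : ℝ) ≤ 1 := by rw [div_le_one (by linarith)]; linarith
  have hq0 : 0 < 1 / (b : ℝ) := by positivity
  have h2 := pow_lt_one₀ (by linarith : 0 ≤ 1 - 1 / (b : ℝ)) (by linarith) hm.ne'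
  have h3 := pow_nonneg (by linarith : 0 ≤ 1 - 1 / (b : ℝ)) m
  have h4 : (b : ℝ) / n < 1 := by rw [div_lt_one (by linarith)]; exact hbn'
  have h5 : 0 < (b : ℝ) / n := div_pos (by linarith) (by linarith)
  rw [etaOW]
  exact ⟨mul_pos h5 (by linarith), by nlinarith⟩

theorem etaWW_mem_Ioo {n b m : ℕ} (hb : 0 < b) (hm : 0 < m) (hn : 2 ≤ n) :
    etaWW n b m ∈ Set.Ioo (0 : ℝ) 1 := by
  obtain ⟨h0, h1⟩ := one_sub_one_div_mem_Ioo hn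
  have hp : 0 < 1 / (n : ℝ) := by linarith
  have hb0 : (0 : ℝ) < b := by exact_mod_cast hb
  have hj : ∀ j ∈ Finset.Icc 1 b, 0 < 1 - (1 - (j : ℝ) / (b : ℝ)) ^ m ∧
      1 - (1 - (j : ℝ) / (b : ℝ)) ^ m ≤ 1 := by
    intro j hj
    obtain ⟨hj1, hj2⟩ := Finset.mem_Icc.1 hj
    have e1 : (j : ℝ) / b ≤ 1 := by rw [div_le_one hb0]; exact_mod_cast hj2
    have e2 : 0 < (j : ℝ) / b := div_pos (by exact_mod_cast hj1) hb0
    have e3 := pow_lt_one₀ (by linarith : 0 ≤ 1 - (j : ℝ) / b) (by linarith) hm.ne'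
    have e4 := pow_nonneg (by linarith : 0 ≤ 1 - (j : ℝ) / b) m
    exact ⟨by linarith, by linarith⟩
  have hB : ∀ j ∈ Finset.Icc 1 b,
      0 < (b.choose j : ℝ) * (1 / (n : ℝ)) ^ j * (1 - 1 / (n : ℝ)) ^ (b - j) := by
    intro j hj
    have : 0 < b.choose j := Nat.choose_pos (Finset.mem_Icc.1 hj).2
    positivity
  rw [etaWW]
  constructor
  · exact Finset.sum_pos (fun j h => mul_pos (hB j h) (hj j h).1)
      ⟨1, Finset.mem_Icc.2 ⟨le_rfl, hb⟩⟩
  · refine lt_of_le_of_lt (Finset.sum_le_sum fun j h =>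
      mul_le_of_le_one_right (hB j h).le (hj j h).2) ?_
    -- The binomial weights with `j ≥ 1` sum to `1 - (1 - 1 / n) ^ b`, which is below `1`.
    have e := add_pow (1 / (n : ℝ)) (1 - 1 / (n : ℝ)) b
    rw [add_sub_cancel, one_pow, sum_range_succ_eq_add_sum_Icc] at e
    simp only [pow_zero, one_mul, Nat.sub_zero, Nat.choose_zero_right, Nat.cast_one, mul_one] at e
    have e2 : ∑ j ∈ Finset.Icc 1 b,
        (b.choose j : ℝ) * (1 / (n : ℝ)) ^ j * (1 - 1 / (n : ℝ)) ^ (b - j) =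
        ∑ j ∈ Finset.Icc 1 b,
        (1 / (n : ℝ)) ^ j * (1 - 1 / (n : ℝ)) ^ (b - j) * (b.choose j : ℝ) :=
      Finset.sum_congr rfl fun j _ => by ring
    rw [e2]
    have := pow_pos h0 b
    linarith

end Combinatorics

/-! ### Occurrence probabilities of a record. -/

section Occurrence

variable {U : Type*} [DecidableEq U]

/-- If the expectation of a function of the number of occurrences of `v` is given by the weights
`c`, then these determine the appearance and occurrence probabilities of `v`. -/
theorem HasExpectation.appearProb_and_sum_countProb {m : ℕ} {p : PMF (Sym U m)}
    {E : (Multiset U → ℝ) → ℝ} (hp : HasExpectation p E) (v : U) {D : (ℕ → ℝ) → ℝ}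
    (hc : ∃ c : ℕ → ℝ, ∀ φ, D φ = ∑ u ∈ Finset.Icc 1 m, c u * φ u)
    (hD : ∀ (F : Multiset U → ℝ) (φ : ℕ → ℝ), (∀ u Y, v ∉ Y → F (Y + u • {v}) = φ u) →
      φ 0 = 0 → E F = D φ) :
    appearProb p v = D (fun _ => 1) ∧
      ∀ δ : ℕ → ℝ, ∑ u ∈ Finset.Icc 1 m, countProb p v u * δ u = D δ := by
  obtain ⟨c, hc⟩ := hc
  have hcount : ∀ u (Y : Multiset U), v ∉ Y → (Y + u • {v}).count v = u := by
    intro u Y hY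
    simp [Multiset.count_eq_zero_of_notMem hY]
  constructor
  · rw [hp.appearProb_eq v, hD _ (fun u => if u = 0 then 0 else 1)
      (fun u Y hY => by rw [hcount u Y hY]) (by simp), hc, hc]
    refine Finset.sum_congr rfl fun u hu => ?_
    have : u ≠ 0 := (Nat.succ_le_iff.1 (Finset.mem_Icc.1 hu).1).ne'
    simp [this]
  · intro δ
    rw [hc]
    refine Finset.sum_congr rfl fun u hu => ?_
    have hu0 : u ≠ 0 := (Nat.succ_le_iff.1 (Finset.mem_Icc.1 hu).1).ne'
    -- The test function is the indicator of `u`; it vanishes at `0` because `u ≥ 1`.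
    rw [hp.countProb_eq v u, hD _ (fun j => if j = u then 1 else 0)
      (fun j Y hY => by rw [hcount j Y hY]) (by simp [hu0.symm]), hc]
    simp [hu]

theorem exists_coe_eq_cons {n : ℕ} {X : Sym U n} {v : U} (h : (X : Multiset U).count v = 1) :
    ∃ x : Multiset U, (X : Multiset U) = v ::ₘ x ∧ v ∉ x ∧ n = Multiset.card x + 1 := by
  obtain ⟨x, hx⟩ := Multiset.exists_cons_of_mem (Multiset.count_pos.1 (by omega :
    0 < (X : Multiset U).count v))
  refine ⟨x, hx, ?_, ?_⟩
  · rw [hx, Multiset.count_cons_self] at h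
    exact Multiset.count_eq_zero.1 (by omega)
  · have h1 : Multiset.card (X : Multiset U) = n := X.2
    rw [← h1, hx, Multiset.card_cons]

end Occurrence

/-! ### Assembly for the three schemes. -/

section Schemes

variable {U Z : Type*} [DecidableEq U] [MeasurableSpace Z] {n b m : ℕ}

theorem mustWO_occurrence (hn : 0 < n) (hmb : m < b) {X : Sym U n} {v : U}
    (hv : (X : Multiset U).count v = 1) :
    appearProb (mustWO hn hmb X) v = etaWO n b m ∧ ∀ δ : ℕ → ℝ,
      ∑ u ∈ Finset.Icc 1 m, countProb (mustWO hn hmb X) v u * δ u = deltaWO n b m δ := by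
  obtain ⟨x, hx, hvx, hnx⟩ := exists_coe_eq_cons hv
  have hδ : ∀ δ, deltaWO n b m δ = hitWeight m δ 1 (Multiset.card x) / (n : ℝ) ^ m := by
    intro δ
    rw [deltaWO_eq_sum hmb, hitWeight_div_eq_sum δ hn (by omega), Nat.cast_one]
  have hη : etaWO n b m = hitWeight m (fun _ => 1) 1 (Multiset.card x) / (n : ℝ) ^ m := by
    rw [etaWO_eq hmb, hitWeight_one_div hn (by omega), Nat.cast_one]
  simp_rw [hδ]
  rw [hη]
  refine (hasExpectation_mustWO hn hmb X).appearProb_and_sum_countProb v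
    (D := fun δ => hitWeight m δ 1 (Multiset.card x) / (n : ℝ) ^ m)
    ⟨_, fun φ => hitWeight_div_eq_sum φ hn (by omega)⟩ fun F φ hφ h0 => ?_
  rw [hx, consSum_cons_pow, consSum_pow_eq_zero_of_notMem hvx hφ h0,
    hitSum_eq_of_notMem hvx hφ, zero_add]

theorem mustOW_occurrence (hb : 0 < b) (hbn : b < n) {X : Sym U n} {v : U}
    (hv : (X : Multiset U).count v = 1) :
    appearProb (mustOW m hb hbn X) v = etaOW n b m ∧ ∀ δ : ℕ → ℝ,
      ∑ u ∈ Finset.Icc 1 m, countProb (mustOW m hb hbn X) v u * δ u = deltaOW n b m δ := by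
  obtain ⟨x, hx, hvx, hnx⟩ := exists_coe_eq_cons hv
  obtain ⟨b, rfl⟩ : ∃ c, b = c + 1 := ⟨b - 1, by omega⟩
  have hδ : ∀ δ, deltaOW n (b + 1) m δ =
      ((b + 1 : ℕ) : ℝ) / n * (hitWeight m δ 1 b / ((b + 1 : ℕ) : ℝ) ^ m) := by
    intro δ
    rw [hitWeight_div_eq_sum δ hb (by omega), Nat.cast_one, deltaOW]
  have hη : etaOW n (b + 1) m =
      ((b + 1 : ℕ) : ℝ) / n * (hitWeight m (fun _ => 1) 1 b / ((b + 1 : ℕ) : ℝ) ^ m) := by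
    rw [hitWeight_one_div hb (by omega), Nat.cast_one, etaOW]
  simp_rw [hδ]
  rw [hη]
  refine (hasExpectation_mustOW m hb hbn X).appearProb_and_sum_countProb v
    (D := fun δ => ((b + 1 : ℕ) : ℝ) / n * (hitWeight m δ 1 b / ((b + 1 : ℕ) : ℝ) ^ m))
    ⟨fun u => ((b + 1 : ℕ) : ℝ) / n * ((m.choose u : ℝ) *
      (((1 : ℕ) : ℝ) / ((b + 1 : ℕ) : ℝ)) ^ u *
      (1 - ((1 : ℕ) : ℝ) / ((b + 1 : ℕ) : ℝ)) ^ (m - u)), fun φ => ?_⟩ fun F φ hφ h0 => ?_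
  · rw [hitWeight_div_eq_sum φ hb (by omega), Finset.mul_sum]
    exact Finset.sum_congr rfl fun u _ => by ring
  · have hs : ∀ c, ∀ s ∈ x.powersetCard c, v ∉ s := fun c s hs h =>
      hvx (Multiset.mem_of_le (Multiset.mem_powersetCard.1 hs).1 h)
    -- Since `φ 0 = 0`, every choice of records that avoids `v` contributes nothing.
    have hz : ∀ c, ((x.powersetCard c).map fun s => (consSum s ^ m) F 0).sum = 0 := by
      intro c
      rw [Multiset.map_congr rfl fun s h =>
        consSum_pow_eq_zero_of_notMem (hs c s h) hφ h0 m]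
      simp
    have hh : ((x.powersetCard b).map fun s => hitSum m F v 1 s).sum =
        ((n - 1).choose b : ℝ) * hitWeight m φ 1 b := by
      rw [(by omega : n - 1 = Multiset.card x), ← sum_map_powersetCard_const]
      congr 1
      refine Multiset.map_congr rfl fun s h => ?_
      rw [hitSum_eq_of_notMem (hs b s h) hφ, (Multiset.mem_powersetCard.1 h).2]
    rw [hx, sum_powersetCard_cons_consSum_pow, hz, hz, hh, add_zero, zero_add, deltaOW_eq hbn]

theorem mustWW_occurrence (hn : 0 < n) (hb : 0 < b) {X : Sym U n} {v : U}
    (hv : (X : Multiset U).count v = 1) :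
    appearProb (mustWW m hn hb X) v = etaWW n b m ∧ ∀ δ : ℕ → ℝ,
      ∑ u ∈ Finset.Icc 1 m, countProb (mustWW m hn hb X) v u * δ u = deltaWW n b m δ := by
  obtain ⟨x, hx, hvx, hnx⟩ := exists_coe_eq_cons hv
  have hη : etaWW n b m = deltaWW n b m (fun _ => 1) := by
    rw [etaWW_eq hn hb, deltaWW_eq hn hb]
  rw [hη]
  refine (hasExpectation_mustWW m hn hb X).appearProb_and_sum_countProb v
    ⟨fun u => ∑ j ∈ Finset.Icc 1 b,
      (b.choose j : ℝ) * (1 / (n : ℝ)) ^ j * (1 - 1 / (n : ℝ)) ^ (b - j) *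
      ((m.choose u : ℝ) * ((j : ℝ) / (b : ℝ)) ^ u * (1 - (j : ℝ) / (b : ℝ)) ^ (m - u)),
      fun φ => ?_⟩ fun F φ hφ h0 => ?_
  · rw [deltaWW]
    simp_rw [Finset.mul_sum, Finset.sum_mul]
    rw [Finset.sum_comm]
    exact Finset.sum_congr rfl fun u _ => Finset.sum_congr rfl fun j _ => by ring
  · rw [hx, consSum_cons_pow_consSum_pow, deltaWW_eq hn hb]
    congr 1
    have hc : ((n - 1 : ℕ) : ℝ) = (Multiset.card x : ℝ) := by rw [hnx, Nat.add_sub_cancel]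
    rw [hc, ← Finset.sum_add_distrib]
    refine Finset.sum_congr rfl fun k _ => ?_
    have hs : ∀ s : Multiset U, (∀ a ∈ s, a ∈ x) → v ∉ s := fun s h hvs => hvx (h v hvs)
    have e1 : (consSum x ^ (b - k)) (fun s => (consSum s ^ m) F 0) 0 = 0 := by
      rw [← mul_zero ((Multiset.card x : ℝ) ^ (b - k)), ← consSum_pow_const x (b - k) 0 0]
      refine consSum_pow_congr fun s _ h => ?_
      rw [add_zero, consSum_pow_eq_zero_of_notMem (hs s h) hφ h0]
    have e2 : (consSum x ^ (b - k)) (fun s => hitSum m F v k s) 0 =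
        (Multiset.card x : ℝ) ^ (b - k) * hitWeight m φ k (b - k) := by
      rw [← consSum_pow_const x (b - k) _ 0]
      refine consSum_pow_congr fun s hsb h => ?_
      rw [add_zero, hitSum_eq_of_notMem (hs s h) hφ, hsb]
    rw [e1, e2]
    ring

variable (M : Sym U m → MeasureTheory.ProbabilityMeasure Z) {ε : ℝ}

theorem isDP_mustWO (hn : 0 < n) (hmb : m < b) (hε : 0 < ε) :
    IsDP (subsampled M (mustWO (U := U) hn hmb)) (epsAmp (etaWO n b m) ε)
      (deltaWO n b m (groupProfile M ε)) := by
  have hη : etaWO n b m = hitWeight m (fun _ => 1) 1 (n - 1) / (n : ℝ) ^ m := by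
    rw [etaWO_eq hmb, hitWeight_one_div hn (by omega), Nat.cast_one]
  have hδ : deltaWO n b m (groupProfile M ε) =
      hitWeight m (groupProfile M ε) 1 (n - 1) / (n : ℝ) ^ m := by
    rw [deltaWO_eq_sum hmb, hitWeight_div_eq_sum _ hn (by omega), Nat.cast_one]
  rw [hη, hδ]
  refine isDP_subsampled
    (E := fun X f => (consSum X ^ m) f 0 / (n : ℝ) ^ m) (hasExpectation_mustWO hn hmb) M hε
    (div_nonneg (hitWeight_nonneg (fun _ => zero_le_one) _ _) (by positivity)) ?_
  intro F hF hF0 hF1 v v' x hnx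
  rw [(by omega : n - 1 = Multiset.card x)]
  exact hF.consSum_cons_pow_div_le (Real.one_le_exp hε.le) (groupProfile_nonneg M ε) hF0 hF1
    v v' x hnx

theorem isDP_mustOW (hb : 0 < b) (hbn : b < n) (hε : 0 < ε) :
    IsDP (subsampled M (mustOW (U := U) m hb hbn)) (epsAmp (etaOW n b m) ε)
      (deltaOW n b m (groupProfile M ε)) := by
  obtain ⟨b, rfl⟩ : ∃ c, b = c + 1 := ⟨b - 1, by omega⟩
  have hη : etaOW n (b + 1) m = (((n - 1).choose b : ℝ) * hitWeight m (fun _ => 1) 1 b) /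
      ((n.choose (b + 1) : ℝ) * ((b + 1 : ℕ) : ℝ) ^ m) := by
    rw [deltaOW_eq hbn, hitWeight_one_div hb (by omega), Nat.cast_one, etaOW]
  have hδ : deltaOW n (b + 1) m (groupProfile M ε) =
      (((n - 1).choose b : ℝ) * hitWeight m (groupProfile M ε) 1 b) /
      ((n.choose (b + 1) : ℝ) * ((b + 1 : ℕ) : ℝ) ^ m) := by
    rw [deltaOW_eq hbn, hitWeight_div_eq_sum _ hb (by omega), Nat.cast_one, deltaOW]
  rw [hη, hδ]
  refine isDP_subsampled
    (E := fun X f => ((X.powersetCard (b + 1)).map fun s => (consSum s ^ m) f 0).sum /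
      ((n.choose (b + 1) : ℝ) * ((b + 1 : ℕ) : ℝ) ^ m)) (hasExpectation_mustOW m hb hbn) M hε
    (div_nonneg (mul_nonneg (by positivity) (hitWeight_nonneg (fun _ => zero_le_one) _ _))
      (by positivity)) ?_
  intro F hF hF0 hF1 v v' x hnx
  exact hF.sum_powersetCard_cons_div_le (Real.one_le_exp hε.le) (groupProfile_nonneg M ε) hF0 hF1
    v v' x hnx hbn

theorem isDP_mustWW (hn : 0 < n) (hb : 0 < b) (hε : 0 < ε) :
    IsDP (subsampled M (mustWW (U := U) m hn hb)) (epsAmp (etaWW n b m) ε)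
      (deltaWW n b m (groupProfile M ε)) := by
  rw [etaWW_eq hn hb, deltaWW_eq hn hb]
  refine isDP_subsampled
    (E := fun X f => (consSum X ^ b) (fun s => (consSum s ^ m) f 0) 0 /
      ((n : ℝ) ^ b * (b : ℝ) ^ m)) (hasExpectation_mustWW m hn hb) M hε
    (div_nonneg (Finset.sum_nonneg fun k _ => mul_nonneg (by positivity)
      (hitWeight_nonneg (fun _ => zero_le_one) _ _)) (by positivity)) ?_
  intro F hF hF0 hF1 v v' x hnx
  rw [(by omega : n - 1 = Multiset.card x)]
  exact hF.consSum_cons_pow_consSum_pow_div_le (Real.one_le_exp hε.le) (groupProfile_nonneg M ε)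
    hF0 hF1 v v' x hnx hb

end Schemes

end Must

theorem theorem4 {U Z : Type*} [DecidableEq U] [MeasurableSpace Z]
    (n b m : ℕ) (hn : 0 < n) (hb : 0 < b) (hm : 0 < m)
    (M : Sym U m → MeasureTheory.ProbabilityMeasure Z) (ε δ : ℝ) (hε : 0 < ε)
    (hM : Must.IsDP M ε δ) :
    -- MUSTwo
    (∀ hmb : m < b,
      Must.IsDP (Must.subsampled M (Must.mustWO (U := U) hn hmb))
        (Must.epsAmp (Must.etaWO n b m) ε)
        (Must.deltaWO n b m (Must.groupProfile M ε)) ∧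
      (∀ (X : Sym U n) (v : U), (X : Multiset U).count v = 1 →
        Must.appearProb (Must.mustWO hn hmb X) v = Must.etaWO n b m ∧
        ∑ u ∈ Finset.Icc 1 m, Must.countProb (Must.mustWO hn hmb X) v u *
          Must.groupProfile M ε u = Must.deltaWO n b m (Must.groupProfile M ε)) ∧
      (2 ≤ n → Must.etaWO n b m ∈ Set.Ioo (0 : ℝ) 1) ∧
      Must.etaWO n b m = 1 - (1 - 1 / (n : ℝ)) ^ m ∧
      Must.deltaWO n b m (Must.groupProfile M ε) =
        ∑ j ∈ Finset.Icc 1 m, (m.choose j : ℝ) * (1 / (n : ℝ)) ^ j *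
          (1 - 1 / (n : ℝ)) ^ (m - j) * Must.groupProfile M ε j) ∧
    -- MUSTow
    (∀ hbn : b < n,
      Must.IsDP (Must.subsampled M (Must.mustOW (U := U) m hb hbn))
        (Must.epsAmp (Must.etaOW n b m) ε)
        (Must.deltaOW n b m (Must.groupProfile M ε)) ∧
      (∀ (X : Sym U n) (v : U), (X : Multiset U).count v = 1 →
        Must.appearProb (Must.mustOW m hb hbn X) v = Must.etaOW n b m ∧
        ∑ u ∈ Finset.Icc 1 m, Must.countProb (Must.mustOW m hb hbn X) v u *
          Must.groupProfile M ε u = Must.deltaOW n b m (Must.groupProfile M ε)) ∧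
      Must.etaOW n b m ∈ Set.Ioo (0 : ℝ) 1) ∧
    -- MUSTww
    (Must.IsDP (Must.subsampled M (Must.mustWW (U := U) m hn hb))
        (Must.epsAmp (Must.etaWW n b m) ε)
        (Must.deltaWW n b m (Must.groupProfile M ε)) ∧
      (∀ (X : Sym U n) (v : U), (X : Multiset U).count v = 1 →
        Must.appearProb (Must.mustWW m hn hb X) v = Must.etaWW n b m ∧
        ∑ u ∈ Finset.Icc 1 m, Must.countProb (Must.mustWW m hn hb X) v u *
          Must.groupProfile M ε u = Must.deltaWW n b m (Must.groupProfile M ε)) ∧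
      (2 ≤ n → Must.etaWW n b m ∈ Set.Ioo (0 : ℝ) 1)) := by
  refine ⟨fun hmb => ⟨Must.isDP_mustWO M hn hmb hε, fun X v hv => ?_, fun hn2 => ?_,
      Must.etaWO_eq hmb, Must.deltaWO_eq_sum hmb _⟩,
    fun hbn => ⟨Must.isDP_mustOW M hb hbn hε, fun X v hv => ?_, Must.etaOW_mem_Ioo hb hm hbn⟩,
    Must.isDP_mustWW M hn hb hε, fun X v hv => ?_, fun hn2 => Must.etaWW_mem_Ioo hb hm hn2⟩
  · exact ⟨(Must.mustWO_occurrence hn hmb hv).1, (Must.mustWO_occurrence hn hmb hv).2 _⟩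
  · rw [Must.etaWO_eq hmb]
    exact Must.one_sub_pow_mem_Ioo hn2 hm
  · exact ⟨(Must.mustOW_occurrence hb hbn hv).1, (Must.mustOW_occurrence hb hbn hv).2 _⟩
  · exact ⟨(Must.mustWW_occurrence hn hb hv).1, (Must.mustWW_occurrence hn hb hv).2 _⟩
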